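/- Let $G=(V,E)$ be a finite connected graph with a (not necessarily proper) colouring $\omega:V\to C$ by a finite colour set $C$. A move $(v,d)\in V\times C$ gives colour $d$ to all vertices in the same monochromatic component as $v$. For $u,v\in V$ and $d\in C$ let $m(u,v,d)$ be the minimum number of moves after which $u$ and $v$ are joined by a monochromatic path of colour $d$, and let $m(u,v)=\min_{d\in C}m(u,v,d)$. Then $m(u,v)$ can be computed for all pairs $(u,v)\in V\times V$ in time $O(|V|^3|E||C|^2)$. Precisely: there are a single program for a unit-cost random access machine (with addition, truncated subtraction, multiplication, indirect addressing and comparison of natural numbers) and a constant $K$ such that, for every such $G$, $C$ and $\omega$, with $V=\{0,\dots,|V|-1\}$ and $C=\{0,\dots,|C|-1\}$, the program, started on $|V|$, $|C|$, $|E|$, the list of the colours of the vertices and a list of the edges in any order, halts after at most $K|V|^3|E||C|^2+K$ steps, puts only numbers at most $K(|V|+|C|)^K$ into its registers (i.e. it uses words of $O(\log(|V|+|C|))$ bits), and leaves the matrix $(m(u,v))_{u,v\in V}$ row by row in the first $|V|^2$ memory cells. -/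

import Mathlib

namespace FloodIt

section Game

variable {V C : Type*}

/-- The graph of the edges of `G` whose two ends have the same colour; its connected components are
the monochromatic components of `G` with colouring `ω`. -/
def mono (G : SimpleGraph V) (ω : V → C) : SimpleGraph V where
  Adj x y := G.Adj x y ∧ ω x = ω y
  symm := ⟨fun _ _ h => ⟨h.1.symm, h.2.symm⟩⟩
  loopless := ⟨fun _ h => h.1.ne rfl⟩

open Classical in
/-- The move `a = (v, d)`: every vertex in the monochromatic component of `v` gets colour `d`. -/
noncomputable def move (G : SimpleGraph V) (ω : V → C) (a : V × C) : V → C :=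
  fun w => if (mono G ω).Reachable a.1 w then a.2 else ω w

/-- The colouring obtained from `ω` by playing the moves of `S` one after the other. -/
noncomputable def play (G : SimpleGraph V) (ω : V → C) (S : List (V × C)) : V → C :=
  S.foldl (move G) ω

/-- `u` and `v` are linked by a monochromatic path of colour `d`. -/
def Linked (G : SimpleGraph V) (ω : V → C) (u v : V) (d : C) : Prop :=
  ∃ p : G.Walk u v, p.IsPath ∧ ∀ w ∈ p.support, ω w = d

/-- `m(u, v, d)`: the minimum number of moves that link `u` and `v` in colour `d`
(`⊤` if there is no such sequence of moves). -/
noncomputable def linkTimeIn (G : SimpleGraph V) (ω : V → C) (u v : V) (d : C) : ℕ∞ :=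
  ⨅ (S : List (V × C)) (_ : Linked G (play G ω S) u v d), (S.length : ℕ∞)

/-- `m(u, v)`, the minimum of `m(u, v, d)` over all colours `d`. -/
noncomputable def linkTime (G : SimpleGraph V) (ω : V → C) (u v : V) : ℕ∞ :=
  ⨅ d : C, linkTimeIn G ω u v d

/-- The list `es` contains every edge of `G` exactly once, each in one of its two orientations. -/
def IsEdgeList (G : SimpleGraph V) (es : List (V × V)) : Prop :=
  (es.map (fun e => s(e.1, e.2))).Nodup ∧
    ∀ e : Sym2 V, e ∈ es.map (fun e => s(e.1, e.2)) ↔ e ∈ G.edgeSet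

end Game

/-! A unit-cost random access machine whose cells hold bounded numbers, with structured control. -/

/-- A memory state: registers, which programs name directly, and an indirectly addressed memory. -/
@[ext] structure State where
  reg : ℕ → ℕ
  mem : ℕ → ℕ

/-- The arithmetic operations. Subtraction is truncated at zero. -/
inductive Arith
  | add
  | sub
  | mul

def Arith.eval : Arith → ℕ → ℕ → ℕ
  | .add, x, y => x + y
  | .sub, x, y => x - y
  | .mul, x, y => x * y

/-- Programs. The arguments `r`, `a`, `b` are names of registers. -/
inductive Prog
  | skip
  /-- `reg[r] := k` -/
  | const (r k : ℕ)
  /-- `reg[r] := reg[a] f reg[b]` -/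
  | arith (f : Arith) (r a b : ℕ)
  /-- `reg[r] := mem[reg[a]]` -/
  | load (r a : ℕ)
  /-- `mem[reg[a]] := reg[r]` -/
  | store (a r : ℕ)
  | seq (P Q : Prog)
  /-- if `reg[a] < reg[b]` then `P` else `Q` -/
  | ifLt (a b : ℕ) (P Q : Prog)
  /-- while `reg[a] < reg[b]` do `P` -/
  | whileLt (a b : ℕ) (P : Prog)

/-- `Exec W P s s' t`: started in state `s`, the program `P` halts in state `s'` after `t` steps.
Each instruction and each evaluation of a test is one step. A number larger than `W` cannot be
put into a register: a run in which this is attempted is stuck and does not halt. -/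
inductive Exec (W : ℕ) : Prog → State → State → ℕ → Prop
  | skip (s : State) : Exec W .skip s s 1
  | const (s : State) (r k : ℕ) (h : k ≤ W) :
      Exec W (.const r k) s ⟨Function.update s.reg r k, s.mem⟩ 1
  | arith (s : State) (f : Arith) (r a b : ℕ) (h : f.eval (s.reg a) (s.reg b) ≤ W) :
      Exec W (.arith f r a b) s
        ⟨Function.update s.reg r (f.eval (s.reg a) (s.reg b)), s.mem⟩ 1
  | load (s : State) (r a : ℕ) (h : s.mem (s.reg a) ≤ W) :
      Exec W (.load r a) s ⟨Function.update s.reg r (s.mem (s.reg a)), s.mem⟩ 1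
  | store (s : State) (a r : ℕ) :
      Exec W (.store a r) s ⟨s.reg, Function.update s.mem (s.reg a) (s.reg r)⟩ 1
  | seq {P Q : Prog} {s s' s'' : State} {t t' : ℕ}
      (h : Exec W P s s' t) (h' : Exec W Q s' s'' t') : Exec W (.seq P Q) s s'' (t + t')
  | ifTrue {a b : ℕ} {P Q : Prog} {s s' : State} {t : ℕ} (hlt : s.reg a < s.reg b)
      (h : Exec W P s s' t) : Exec W (.ifLt a b P Q) s s' (t + 1)
  | ifFalse {a b : ℕ} {P Q : Prog} {s s' : State} {t : ℕ} (hlt : ¬ s.reg a < s.reg b)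
      (h : Exec W Q s s' t) : Exec W (.ifLt a b P Q) s s' (t + 1)
  | whileTrue {a b : ℕ} {P : Prog} {s s' s'' : State} {t t' : ℕ} (hlt : s.reg a < s.reg b)
      (h : Exec W P s s' t) (h' : Exec W (.whileLt a b P) s' s'' t') :
      Exec W (.whileLt a b P) s s'' (t + t' + 1)
  | whileFalse {a b : ℕ} {P : Prog} {s : State} (hlt : ¬ s.reg a < s.reg b) :
      Exec W (.whileLt a b P) s s 1

/-- The encoding of a coloured graph with vertices `0, …, n - 1`, colours `0, …, c - 1` and list of
edges `es`: the numbers `n`, `c`, `|E|`, then the colours of the vertices in order, then the two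
ends of each edge. -/
def encode {n c : ℕ} (ω : Fin n → Fin c) (es : List (Fin n × Fin n)) : List ℕ :=
  [n, c, es.length] ++ List.ofFn (fun v => (ω v : ℕ)) ++
    es.flatMap (fun e => [(e.1 : ℕ), (e.2 : ℕ)])

/-- The initial state: the input stands in the first memory cells, everything else is zero. -/
def initState (x : List ℕ) : State := ⟨fun _ => 0, fun i => x.getD i 0⟩

end FloodIt

/-! ### Flooding a word of colours -/

namespace FloodIt

/-! The heart of the proof is a description of `m(u, v, d)` that involves no dynamics: `m(u, v, d) ≤
k` exactly when some walk from `u` to `v` has a colour word that is flooded with `d` at cost `k` by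
recolouring and concatenating (`linkTimeIn_le_iff`).

From moves to walks, moves are undone one at a time, the last one first (`Route.of_move`). The walk
is rerouted so that it meets the moved component in one block; that block is monochromatic before
the move and costs one recolouring. From walks to moves, some recolouring of a monochromatic segment
can be carried out first (`Floods.exists_first`) and is played as a genuine move
(`Route.exists_linked`). In both directions the rerouted walk is harmless because deleting letters
never raises the cost (`Floods.sublist`).

Hence `m` is the least table with `m(u, u, ω u) = 0`, `m(u, v, d) ≤ m(u, v, d') + 1`, and `m(u, v,
d) ≤ m(u, x, d) + m(y, v, d)` for adjacent `x`, `y`. It is computed in the manner of Bellman and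
Ford. All entries start at `n`, which connectedness permits (`Route.card`), except zeros on the
diagonal. A walk may be taken without repeated vertices and successive recolourings merge into one,
so `2 * n` rounds suffice (`Route.level`). A round tries each `(u, v, d)` with each edge and each
colour `d'`, which gives `2 * n * (n * n * c * |E| * c)` relaxations of constant cost. -/

/-- `Floods w d k`: a path whose vertices carry the colours `w` in order can be given the single
colour `d` at cost `k`, by recolouring monochromatic segments and concatenating. -/
inductive Floods {C : Type*} : List C → C → ℕ → Prop
  | single (c : C) : Floods [c] c 0
  | recolour {w : List C} {d k} (d' : C) (h : Floods w d k) : Floods w d' (k + 1)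
  | append {w w' : List C} {d k k'} (h : Floods w d k) (h' : Floods w' d k') :
      Floods (w ++ w') d (k + k')

namespace Floods

variable {C : Type*} {w w' : List C} {d e : C} {k k' : ℕ}

theorem ne_nil (h : Floods w d k) : w ≠ [] := by
  induction h <;> simp_all

/-- Recolouring with the colour already present wastes one unit, so costs act as upper bounds. -/
theorem mono (h : Floods w d k) (hk : k ≤ k') : Floods w d k' := by
  induction hk with
  | refl => exact h
  | step _ ih => exact ih.recolour d

theorem of_forall_eq (hw : w ≠ []) (h : ∀ x ∈ w, x = d) : Floods w d 0 := by
  induction w with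
  | nil => exact absurd rfl hw
  | cons a l ih =>
    obtain rfl : a = d := h a (by simp)
    rcases eq_or_ne l [] with rfl | hl
    · exact .single a
    · exact (Floods.single a).append (ih hl fun x hx => h x (by simp [hx]))

theorem length (hw : w ≠ []) : Floods w d w.length := by
  induction w with
  | nil => exact absurd rfl hw
  | cons a l ih =>
    have h1 : Floods [a] d 1 := (Floods.single a).recolour d
    rcases eq_or_ne l [] with rfl | hl
    · exact h1
    · simpa [add_comm] using h1.append (ih hl)

/-- The same derivation works on the letters that remain; a half that has become empty is dropped
and its cost wasted. -/
theorem sublist (h : Floods w d k) (hs : w'.Sublist w) (hw : w' ≠ []) : Floods w' d k := by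
  induction h generalizing w' with
  | single c =>
    rcases List.sublist_singleton.1 hs with rfl | rfl
    · exact absurd rfl hw
    · exact .single c
  | recolour d' h ih => exact (ih hs hw).recolour d'
  | append h h' ih ih' =>
    obtain ⟨a, b, rfl, ha, hb⟩ := List.sublist_append_iff.1 hs
    rcases eq_or_ne a [] with rfl | ha0
    · exact (ih' hb (by simpa using hw)).mono (by omega)
    rcases eq_or_ne b [] with rfl | hb0
    · simpa using (ih ha ha0).mono (by omega)
    exact (ih ha ha0).append (ih' hb hb0)

/-- The chosen letter is a leaf of the derivation; the derivation for `w'` is grafted onto that leaf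
and its cost is paid once. -/
theorem subst (h : Floods w d k) {w₁ w₂ : List C} (hw : w = w₁ ++ e :: w₂)
    (h' : Floods w' e k') : Floods (w₁ ++ w' ++ w₂) d (k + k') := by
  induction h generalizing w₁ w₂ with
  | single c =>
    rcases w₁ with _ | ⟨a, l⟩
    · simp only [List.nil_append, List.cons.injEq] at hw
      obtain ⟨rfl, rfl⟩ := hw
      simpa using h'
    · simp at hw
  | recolour d' h ih => exact ((ih hw).recolour d').mono (by omega)
  | @append a b d k l ha hb iha ihb =>
    rcases List.append_eq_append_iff.1 hw with ⟨t, rfl, rfl⟩ | ⟨t, rfl, ht⟩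
    · simpa [add_assoc] using ha.append (ihb rfl)
    -- For empty `t` the chosen letter is the first one of the second word, so it still belongs to
    -- that half.
    · rcases t with _ | ⟨x, t⟩
      · have := ha.append (ihb (w₁ := []) (w₂ := w₂) (by simpa using ht.symm))
        simpa [add_assoc] using this
      · simp only [List.cons_append, List.cons.injEq] at ht
        obtain ⟨rfl, rfl⟩ := ht
        have := (iha rfl).append hb
        simp only [List.append_assoc] at this ⊢
        exact this.mono (by omega)

/-- Unless the word is already monochromatic in the required colour, some recolouring is of a
monochromatic segment and can be carried out first. -/
theorem exists_first (h : Floods w d k) : (∀ x ∈ w, x = d) ∨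
    ∃ (w₁ mid w₂ : List C) (c e : C) (j : ℕ), w = w₁ ++ mid ++ w₂ ∧ mid ≠ [] ∧
      (∀ x ∈ mid, x = c) ∧ Floods (w₁ ++ e :: w₂) d j ∧ k = j + 1 := by
  induction h with
  | single c => simp
  | @recolour w d k d' h ih =>
    right
    rcases ih with h1 | ⟨w₁, mid, w₂, c, e, j, rfl, hm, hc, hf, rfl⟩
    -- The whole word is the segment; the remaining word is the single letter `d'`, whose cost `0`
    -- is padded to `k`.
    · exact ⟨[], w, [], d, d', k, by simp, h.ne_nil, h1,
        (Floods.single d').mono (Nat.zero_le _), rfl⟩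
    · exact ⟨w₁, mid, w₂, c, e, j + 1, rfl, hm, hc, hf.recolour d', rfl⟩
  | @append a b d k l ha hb iha ihb =>
    rcases iha with h1 | ⟨w₁, mid, w₂, c, e, j, rfl, hm, hc, hf, rfl⟩
    · rcases ihb with h2 | ⟨w₁, mid, w₂, c, e, j, rfl, hm, hc, hf, rfl⟩
      · left
        intro x hx
        rcases List.mem_append.1 hx with hx | hx
        exacts [h1 x hx, h2 x hx]
      · right
        refine ⟨a ++ w₁, mid, w₂, c, e, k + j, by simp, hm, hc, ?_, by omega⟩
        simpa using ha.append hf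
    · right
      refine ⟨w₁, mid, w₂ ++ b, c, e, j + l, by simp, hm, hc, ?_, by omega⟩
      simpa using hf.append hb

end Floods

/-! ### Walks as lists of vertices: cutting, gluing and rerouting -/

section Route

variable {V C : Type*} {G : SimpleGraph V}

/-- `L` lists the vertices of a walk from `u` to `v`. -/
def IsWalk (G : SimpleGraph V) (L : List V) (u v : V) : Prop :=
  L.IsChain G.Adj ∧ L.head? = some u ∧ L.getLast? = some v

theorem IsWalk.ne_nil {L : List V} {u v : V} (h : IsWalk G L u v) : L ≠ [] := by
  rintro rfl; simp [IsWalk] at h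

theorem IsWalk.singleton (u : V) : IsWalk G [u] u u := by simp [IsWalk]

theorem IsWalk.append {L L' : List V} {u v x y : V} (h : IsWalk G L u x) (hxy : G.Adj x y)
    (h' : IsWalk G L' y v) : IsWalk G (L ++ L') u v := by
  obtain ⟨h1, h2, h3⟩ := h
  obtain ⟨h1', h2', h3'⟩ := h'
  refine ⟨List.isChain_append.2 ⟨h1, h1', ?_⟩, by simp [h2], by simp [h3']⟩
  simp only [h3, h2', Option.mem_def, Option.some.injEq]
  rintro _ rfl _ rfl
  exact hxy

/-- Splitting a walk at a point, keeping the vertex on both sides. -/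
theorem IsWalk.split {L L' : List V} {u v x : V} (h : IsWalk G (L ++ x :: L') u v) :
    IsWalk G (L ++ [x]) u x ∧ IsWalk G (x :: L') x v := by
  obtain ⟨h1, h2, h3⟩ := h
  rw [List.isChain_append] at h1
  obtain ⟨ha, hb, hc⟩ := h1
  refine ⟨⟨List.isChain_append.2 ⟨ha, by simp, ?_⟩, ?_, by simp⟩, hb, by simp, ?_⟩
  · simpa using hc
  · cases L <;> simpa using h2
  · simpa [List.getLast?_append] using h3

/-- Gluing walks at a common vertex. -/
theorem IsWalk.glue {L L' : List V} {u v x : V} (h : IsWalk G (L ++ [x]) u x)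
    (h' : IsWalk G (x :: L') x v) : IsWalk G (L ++ x :: L') u v := by
  obtain ⟨h1, h2, h3⟩ := h
  obtain ⟨h1', h2', h3'⟩ := h'
  rw [List.isChain_append] at h1
  refine ⟨List.isChain_append.2 ⟨h1.1, h1', by simpa using h1.2.2⟩, ?_, ?_⟩
  · cases L <;> simpa using h2
  · simpa [List.getLast?_append] using h3'

theorem exists_first_mem (A : Set V) (l : List V) {x : V} (hx : x ∈ A) (r : List V) :
    ∃ (l₁ : List V) (p : V) (r' : List V), l ++ x :: r = l₁ ++ p :: r' ∧ l₁.Sublist l ∧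
      (∀ y ∈ l₁, y ∉ A) ∧ p ∈ A := by
  induction l with
  | nil => exact ⟨[], x, r, by simp, by simp, by simp, hx⟩
  | cons a l ih =>
    by_cases ha : a ∈ A
    · exact ⟨[], a, l ++ x :: r, by simp, by simp, by simp, ha⟩
    · obtain ⟨l₁, p, r', h1, h2, h3, h4⟩ := ih
      refine ⟨a :: l₁, p, r', by simp [h1], h2.cons_cons a, ?_, h4⟩
      simpa using ⟨ha, h3⟩

theorem exists_last_mem (A : Set V) (r : List V) {x : V} (hx : x ∈ A) :
    ∃ (l : List V) (q : V) (r₁ : List V), x :: r = l ++ q :: r₁ ∧ r₁.Sublist r ∧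
      (∀ y ∈ r₁, y ∉ A) ∧ q ∈ A := by
  obtain ⟨l₁, p, r', h1, h2, h3, h4⟩ := exists_first_mem A r.reverse hx []
  refine ⟨r'.reverse, p, l₁.reverse, ?_, ?_, by simpa using h3, h4⟩
  · have := congrArg List.reverse h1
    simpa using this
  · simpa using h2.reverse

/-- Everything between the first and the last visit to `A` is replaced by a walk inside `A`. As
`mid` lies in `A`, what is kept before and after comes from `l` and from `r`, which later allows
`Floods.sublist` to be applied. -/
theorem IsWalk.splice {A : Set V} (hA : ∀ p ∈ A, ∀ q ∈ A, ∃ P, IsWalk G P p q ∧ ∀ y ∈ P, y ∈ A)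
    {l mid r : List V} {u v : V} (h : IsWalk G (l ++ mid ++ r) u v) (hm : mid ≠ [])
    (hmA : ∀ y ∈ mid, y ∈ A) :
    ∃ l₁ P r₁ : List V, l₁.Sublist l ∧ r₁.Sublist r ∧ (∀ y ∈ l₁, y ∉ A) ∧ (∀ y ∈ r₁, y ∉ A) ∧
      P ≠ [] ∧ (∀ y ∈ P, y ∈ A) ∧ IsWalk G (l₁ ++ P ++ r₁) u v := by
  obtain ⟨x, mid', rfl⟩ := List.exists_cons_of_ne_nil hm
  obtain ⟨l₁, p, R, h1, h2, h3, hp⟩ := exists_first_mem A l (hmA x (by simp)) (mid' ++ r)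
  -- The last vertex `z` of `mid` anchors the search for the last visit, so that only vertices of
  -- `r` can follow it.
  obtain ⟨m, z, hz⟩ : ∃ m z, x :: mid' = m ++ [z] :=
    ⟨_, _, (List.dropLast_append_getLast hm).symm⟩
  obtain ⟨S, q, r₁, g1, g2, g3, hq⟩ := exists_last_mem A r (hmA z (by simp [hz]))
  have e1 : l ++ x :: mid' ++ r = l₁ ++ p :: R := by simpa using h1
  have e2 : l ++ x :: mid' ++ r = (l ++ m ++ S) ++ q :: r₁ := by
    rw [hz]; simp [← g1]
  obtain ⟨a1, -⟩ := (e1 ▸ h).split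
  obtain ⟨-, a2⟩ := (e2 ▸ h).split
  obtain ⟨P, hP, hPA⟩ := hA p hp q hq
  refine ⟨l₁, P, r₁, h2, g2, h3, g3, hP.ne_nil, hPA, ?_⟩
  have b1 : IsWalk G (l₁ ++ P) u q := by
    obtain ⟨y, P', rfl⟩ := List.exists_cons_of_ne_nil hP.ne_nil
    obtain rfl : y = p := by simpa using hP.2.1
    exact a1.glue hP
  have hPe := hP.ne_nil
  obtain ⟨P', y, rfl⟩ : ∃ m z, P = m ++ [z] := ⟨_, _, (List.dropLast_append_getLast hPe).symm⟩
  obtain rfl : y = q := by simpa using hP.2.2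
  simpa using IsWalk.glue (L := l₁ ++ P') (by simpa using b1) a2

/-- Loops between two occurrences of a vertex are cut out. The result is a sublist, so its word
costs no more. -/
theorem IsWalk.exists_nodup {L : List V} {u v : V} (h : IsWalk G L u v) :
    ∃ L', L'.Sublist L ∧ L'.Nodup ∧ IsWalk G L' u v := by
  induction hn : L.length using Nat.strong_induction_on generalizing L with
  | _ n ih =>
    by_cases hd : L.Nodup
    · exact ⟨L, List.Sublist.refl _, hd, h⟩
    · obtain ⟨x, hx⟩ : ∃ x, [x, x].Sublist L := by
        by_contra hcon
        exact hd (List.nodup_iff_sublist.2 (by simpa using hcon))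
      obtain ⟨a, b, rfl, ha, hb⟩ := List.cons_sublist_iff.1 hx
      rw [List.singleton_sublist] at hb
      obtain ⟨a1, a2, rfl⟩ := List.append_of_mem ha
      obtain ⟨b1, b2, rfl⟩ := List.append_of_mem hb
      have s1 := (IsWalk.split (L := a1) (x := x) (L' := a2 ++ (b1 ++ x :: b2))
        (by simpa using h)).1
      have s2 := (IsWalk.split (L := a1 ++ x :: a2 ++ b1) (x := x) (L' := b2)
        (by simpa using h)).2
      obtain ⟨L', hs, hnd, hw⟩ := ih _ (by simp at hn ⊢; omega) (s1.glue s2) rfl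
      refine ⟨L', hs.trans ?_, hnd, hw⟩
      have hb2 : b2.Sublist (a2 ++ (b1 ++ x :: b2)) :=
        ((List.sublist_cons_self x b2).trans (List.sublist_append_right b1 _)).trans
          (List.sublist_append_right a2 _)
      simpa using hb2

end Route
-- Linking by moves equals flooding the word of a walk
section Moves

variable {V C : Type*} {G : SimpleGraph V} {ω : V → C}

/-- Some walk from `u` to `v` has a colour word that can be flooded with `d` at cost `k`. -/
def Route (G : SimpleGraph V) (ω : V → C) (u v : V) (d : C) (k : ℕ) : Prop :=
  ∃ L, IsWalk G L u v ∧ Floods (L.map ω) d k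

theorem exists_isWalk_of_walk_mono {u v : V} (p : (mono G ω).Walk u v) :
    ∃ L, IsWalk G L u v ∧ ∀ y ∈ L, (mono G ω).Reachable u y := by
  induction p with
  | nil => exact ⟨[_], IsWalk.singleton _, by simp⟩
  | cons h p ih =>
    obtain ⟨L, hL, hr⟩ := ih
    refine ⟨_ :: L, (IsWalk.singleton _).append h.1 hL, ?_⟩
    simp only [List.mem_cons, forall_eq_or_imp, SimpleGraph.Reachable.refl, true_and]
    exact fun y hy => h.reachable.trans (hr y hy)

theorem color_eq_of_reachable {u v : V} (h : (mono G ω).Reachable u v) : ω u = ω v := by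
  obtain ⟨p⟩ := h
  induction p with
  | nil => rfl
  | cons h p ih => exact h.2.trans ih

/-- Monochromatic components are connected by walks. -/
theorem component_isWalk (a : V) : ∀ p ∈ {y | (mono G ω).Reachable a y},
    ∀ q ∈ {y | (mono G ω).Reachable a y},
      ∃ P, IsWalk G P p q ∧ ∀ y ∈ P, y ∈ {y | (mono G ω).Reachable a y} := by
  intro p hp q hq
  obtain ⟨w⟩ := (SimpleGraph.Reachable.symm hp).trans hq
  obtain ⟨P, h1, h2⟩ := exists_isWalk_of_walk_mono w
  exact ⟨P, h1, fun y hy => SimpleGraph.Reachable.trans hp (h2 y hy)⟩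

theorem move_of_reachable {a : V × C} {y : V} (h : (mono G ω).Reachable a.1 y) :
    move G ω a y = a.2 := if_pos h

theorem move_of_not_reachable {a : V × C} {y : V} (h : ¬ (mono G ω).Reachable a.1 y) :
    move G ω a y = ω y := if_neg h

theorem Route.mono {u v : V} {d : C} {k k' : ℕ} (h : Route G ω u v d k) (hk : k ≤ k') :
    Route G ω u v d k' := by
  obtain ⟨L, h1, h2⟩ := h
  exact ⟨L, h1, h2.mono hk⟩

theorem Route.refl (u : V) : Route G ω u u (ω u) 0 :=
  ⟨[u], IsWalk.singleton u, .single _⟩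

theorem Route.recolour {u v : V} {d : C} {k : ℕ} (h : Route G ω u v d k) (d' : C) :
    Route G ω u v d' (k + 1) := by
  obtain ⟨L, h1, h2⟩ := h
  exact ⟨L, h1, h2.recolour d'⟩

theorem Route.append {u v x y : V} {d : C} {k k' : ℕ} (h : Route G ω u x d k) (hxy : G.Adj x y)
    (h' : Route G ω y v d k') : Route G ω u v d (k + k') := by
  obtain ⟨L, h1, h2⟩ := h
  obtain ⟨L', h1', h2'⟩ := h'
  refine ⟨L ++ L', h1.append hxy h1', ?_⟩
  rw [List.map_append]
  exact h2.append h2'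

theorem IsWalk.exists_path {L : List V} {u v : V} (h : IsWalk G L u v) :
    ∃ p : G.Walk u v, p.IsPath ∧ ∀ y ∈ p.support, y ∈ L := by
  classical
  suffices ∃ p : G.Walk u v, ∀ y ∈ p.support, y ∈ L by
    obtain ⟨p, hp⟩ := this
    exact ⟨p.bypass, p.bypass_isPath, fun y hy => hp y (p.support_bypass_subset_support hy)⟩
  induction L generalizing u with
  | nil => exact absurd rfl h.ne_nil
  | cons a l ih =>
    obtain rfl : a = u := by simpa using h.2.1
    rcases l with _ | ⟨b, l⟩
    · obtain rfl : a = v := by simpa using h.2.2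
      exact ⟨.nil, by simp⟩
    · obtain ⟨h1, -, h3⟩ := h
      rw [List.isChain_cons_cons] at h1
      obtain ⟨p, hp⟩ := ih (u := b) ⟨h1.2, by simp, by simpa using h3⟩
      refine ⟨.cons h1.1 p, ?_⟩
      simp only [SimpleGraph.Walk.support_cons, List.mem_cons, forall_eq_or_imp, true_or, true_and]
      exact fun y hy => .inr (by simpa using hp y hy)

theorem isWalk_support {u v : V} (p : G.Walk u v) : IsWalk G p.support u v := by
  induction p with
  | nil => exact IsWalk.singleton _
  | cons h p ih => exact (IsWalk.singleton _).append h ih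

theorem map_move_eq {a : V × C} {l : List V}
    (h : ∀ y ∈ l, y ∉ {y | (FloodIt.mono G ω).Reachable a.1 y}) : l.map (move G ω a) = l.map ω :=
  List.map_congr_left fun y hy => move_of_not_reachable (h y hy)

/-- Undoing a move costs at most one. -/
theorem Route.of_move {u v : V} {d : C} {k : ℕ} {a : V × C}
    (h : Route G (move G ω a) u v d k) : Route G ω u v d (k + 1) := by
  obtain ⟨L, h1, h2⟩ := h
  by_cases hx : ∃ x ∈ L, (FloodIt.mono G ω).Reachable a.1 x
  · obtain ⟨x, hxL, hx⟩ := hx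
    obtain ⟨l, r, rfl⟩ := List.append_of_mem hxL
    obtain ⟨l₁, P, r₁, s1, s2, n1, n2, hP, hPA, hw⟩ :=
      IsWalk.splice (component_isWalk (ω := ω) a.1) (l := l) (mid := [x]) (r := r)
        (by simpa using h1) (by simp) (by simpa using hx)
    refine ⟨_, hw, ?_⟩
    -- Outside the component the move changed nothing, so this is a subword of the colour word after
    -- the move, with one letter standing for the whole component.
    have f1 : Floods (l₁.map ω ++ a.2 :: r₁.map ω) d k := by
      refine h2.sublist ?_ (by simp)
      rw [← map_move_eq n1, ← map_move_eq n2, List.map_append, List.map_cons,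
        move_of_reachable hx]
      exact (s1.map _).append ((s2.map _).cons_cons _)
    have f2 : Floods (P.map ω) (ω a.1) 0 := by
      refine .of_forall_eq (by simpa using hP) ?_
      simp only [List.mem_map, forall_exists_index, and_imp, forall_apply_eq_imp_iff₂]
      exact fun y hy => (color_eq_of_reachable (hPA y hy)).symm
    simpa using f1.subst rfl (f2.recolour a.2)
  · refine ⟨L, h1, ?_⟩
    rw [map_move_eq (by simpa using hx)] at h2
    exact h2.mono (Nat.le_succ k)

theorem Route.of_linked {u v : V} {d : C} (S : List (V × C)) (h : Linked G (play G ω S) u v d) :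
    Route G ω u v d S.length := by
  induction S generalizing ω with
  | nil =>
    obtain ⟨p, -, hp⟩ := h
    refine ⟨p.support, isWalk_support p, .of_forall_eq (by simp) ?_⟩
    simpa [play] using hp
  | cons a S ih => exact (ih h).of_move

theorem reachable_of_isChain {c : C} {x : V} {l : List V} (h : (x :: l).IsChain G.Adj)
    (hc : ∀ y ∈ x :: l, ω y = c) : ∀ y ∈ x :: l, (FloodIt.mono G ω).Reachable x y := by
  induction l generalizing x with
  | nil => simp
  | cons b l ih =>
    rw [List.isChain_cons_cons] at h
    intro y hy
    rcases List.mem_cons.1 hy with rfl | hy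
    · exact .refl _
    · have hb : (FloodIt.mono G ω).Adj x b := ⟨h.1, by rw [hc x (by simp), hc b (by simp)]⟩
      exact hb.reachable.trans (ih h.2 (fun z hz => hc z (List.mem_cons_of_mem _ hz)) y hy)

/-- Strong induction on the cost: a segment whose recolouring can come first is recoloured by a
move. The move affects its whole component, which the walk may also visit elsewhere, so the walk is
rerouted to meet it in one block, now of colour `e`. -/
theorem Route.exists_linked {u v : V} {d : C} {k : ℕ} (h : Route G ω u v d k) :
    ∃ S : List (V × C), S.length ≤ k ∧ Linked G (play G ω S) u v d := by
  induction k using Nat.strong_induction_on generalizing ω with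
  | _ k ih =>
    obtain ⟨L, h1, h2⟩ := h
    rcases h2.exists_first with hd | ⟨w₁, w, w₂, c, e, j, hL, hm, hc, hf, rfl⟩
    · obtain ⟨p, hp, hs⟩ := h1.exists_path
      exact ⟨[], by simp, p, hp, fun y hy => hd _ (List.mem_map_of_mem (hs y hy))⟩
    · rw [List.map_eq_append_iff] at hL
      obtain ⟨l', r, rfl, hL, rfl⟩ := hL
      rw [List.map_eq_append_iff] at hL
      obtain ⟨l, mid, rfl, rfl, rfl⟩ := hL
      obtain ⟨x, t, rfl⟩ := List.exists_cons_of_ne_nil (l := mid) (by simpa using hm)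
      have hch : (x :: t).IsChain G.Adj :=
        ((List.isChain_append.1 (List.isChain_append.1 h1.1).1)).2.1
      have hr := reachable_of_isChain (ω := ω) (c := c) hch
        (fun y hy => hc _ (List.mem_map_of_mem hy))
      obtain ⟨l₁, P, r₁, s1, s2, n1, n2, hP, hPA, hw⟩ :=
        IsWalk.splice (component_isWalk (ω := ω) x) h1 (by simp) hr
      have f1 : Floods (l₁.map ω ++ e :: r₁.map ω) d j :=
        hf.sublist ((s1.map _).append ((s2.map _).cons_cons _)) (by simp)
      have f2 : Floods (P.map (move G ω (x, e))) e 0 := by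
        refine .of_forall_eq (by simpa using hP) ?_
        simp only [List.mem_map, forall_exists_index, and_imp, forall_apply_eq_imp_iff₂]
        exact fun y hy => move_of_reachable (a := (x, e)) (hPA y hy)
      have f3 := f1.subst rfl f2
      rw [← map_move_eq (a := (x, e)) n1, ← map_move_eq (a := (x, e)) n2, ← List.map_append,
        ← List.map_append] at f3
      obtain ⟨S, hS, hl⟩ := ih j (by omega) ⟨_, hw, f3⟩
      exact ⟨(x, e) :: S, by simpa using hS, hl⟩

theorem linkTimeIn_le_iff {u v : V} {d : C} {k : ℕ} :
    linkTimeIn G ω u v d ≤ k ↔ Route G ω u v d k := by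
  constructor
  · intro h
    -- A strict bound is needed to extract an actual sequence of moves from the infimum.
    have h' : linkTimeIn G ω u v d < ((k + 1 : ℕ) : ℕ∞) :=
      h.trans_lt (by exact_mod_cast Nat.lt_succ_self k)
    simp only [linkTimeIn, iInf_lt_iff] at h'
    obtain ⟨S, hS, hk⟩ := h'
    exact (Route.of_linked S hS).mono (by
      have : S.length < k + 1 := by exact_mod_cast hk
      omega)
  · intro h
    obtain ⟨S, hS, hl⟩ := h.exists_linked
    exact (iInf₂_le S hl).trans (by exact_mod_cast hS)

/-- Routes obtained in at most `r` rounds of recolouring and concatenating. -/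
inductive Level (G : SimpleGraph V) (ω : V → C) : ℕ → V → V → C → ℕ → Prop
  | refl (r : ℕ) (u : V) : Level G ω r u u (ω u) 0
  | recolour {r : ℕ} {u v : V} {d : C} {k : ℕ} (d' : C) (h : Level G ω r u v d k) :
      Level G ω (r + 1) u v d' (k + 1)
  | append {r : ℕ} {u v x y : V} {d : C} {k k' : ℕ} (h : Level G ω r u x d k) (hxy : G.Adj x y)
      (h' : Level G ω r y v d k') : Level G ω (r + 1) u v d (k + k')

theorem Level.mono {r r' : ℕ} {u v : V} {d : C} {k : ℕ} (h : Level G ω r u v d k) (hr : r ≤ r') :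
    Level G ω r' u v d k := by
  induction h generalizing r' with
  | refl r u => exact .refl r' u
  | recolour d' h ih =>
    obtain ⟨s, rfl⟩ : ∃ s, r' = s + 1 := ⟨r' - 1, by omega⟩
    exact .recolour d' (ih (by omega))
  | append h hxy h' ih ih' =>
    obtain ⟨s, rfl⟩ : ∃ s, r' = s + 1 := ⟨r' - 1, by omega⟩
    exact .append (ih (by omega)) hxy (ih' (by omega))

/-- A word of length `m` needs only `m - 1` concatenations, each accounting for two levels: itself
and one merged recolouring before it. The second alternative keeps a final recolouring pending, with
its unit of cost unspent, so that repeated recolourings do not add levels. -/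
theorem Floods.level {w : List C} {d : C} {k : ℕ} (h : Floods w d k) {L : List V} {u v : V}
    (hL : IsWalk G L u v) (hw : L.map ω = w) :
    (∃ k' ≤ k, Level G ω (2 * w.length - 2) u v d k') ∨
      ∃ d' k', k' + 1 ≤ k ∧ Level G ω (2 * w.length - 2) u v d' k' := by
  induction h generalizing L u v with
  | single c =>
    left
    obtain ⟨a, rfl, rfl⟩ := List.map_eq_singleton_iff.1 hw
    obtain rfl : a = u := by simpa using hL.2.1
    obtain rfl : a = v := by simpa using hL.2.2
    exact ⟨0, le_rfl, .refl _ _⟩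
  | recolour d' h ih =>
    right
    rcases ih hL hw with ⟨k', hk, hl⟩ | ⟨e, k', hk, hl⟩
    · exact ⟨_, k', by omega, hl⟩
    · exact ⟨e, k', by omega, hl⟩
  | @append w w' d k l h h' ih ih' =>
    left
    obtain ⟨L₁, L₂, rfl, rfl, rfl⟩ := List.map_eq_append_iff.1 hw
    have n1 : L₁ ≠ [] := by simpa using h.ne_nil
    have n2 : L₂ ≠ [] := by simpa using h'.ne_nil
    obtain ⟨M, x, rfl⟩ : ∃ m z, L₁ = m ++ [z] := ⟨_, _, (List.dropLast_append_getLast n1).symm⟩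
    obtain ⟨y, N, rfl⟩ := List.exists_cons_of_ne_nil n2
    have hxy : G.Adj x y := by
      have := (List.isChain_append.1 hL.1).2.2
      simpa using this
    have w1 : IsWalk G (M ++ [x]) u x := (IsWalk.split (by simpa using hL)).1
    have w2 : IsWalk G (y :: N) y v := (IsWalk.split hL).2
    -- The pending recolouring is carried out here, at the price of one level.
    have up : ∀ {p q : V} {d : C} {k m : ℕ}, 1 ≤ m →
        ((∃ k' ≤ k, Level G ω (2 * m - 2) p q d k') ∨
        ∃ d' k', k' + 1 ≤ k ∧ Level G ω (2 * m - 2) p q d' k') →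
        ∃ k' ≤ k, Level G ω (2 * m - 1) p q d k' := by
      intro p q d k m hm hh
      rcases hh with ⟨k', hk, hl⟩ | ⟨e, k', hk, hl⟩
      · exact ⟨k', hk, hl.mono (by omega)⟩
      · exact ⟨k' + 1, hk, (hl.recolour d).mono (by omega)⟩
    obtain ⟨k1, hk1, hl1⟩ := up (by simp) (ih w1 rfl)
    obtain ⟨k2, hk2, hl2⟩ := up (by simp) (ih' w2 rfl)
    refine ⟨k1 + k2, by omega, ?_⟩
    simp only [List.length_map, List.length_append, List.length_cons, List.length_nil] at hl1 hl2 ⊢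
    -- Both halves are nonempty, so each level `2 * mᵢ - 1` is at most `2 * (m₁ + m₂) - 3`.
    exact (Level.append (hl1.mono (r' := 2 * (M.length + 1 + (N.length + 1)) - 3) (by omega)) hxy
      (hl2.mono (by omega))).mono (by omega)

theorem IsWalk.exists_le_card [Fintype V] {L : List V} {u v : V} (h : IsWalk G L u v) :
    ∃ L', L'.Sublist L ∧ L'.length ≤ Fintype.card V ∧ IsWalk G L' u v := by
  obtain ⟨L', h1, h2, h3⟩ := h.exists_nodup
  exact ⟨L', h1, h2.length_le_card, h3⟩

theorem Route.level [Fintype V] {u v : V} {d : C} {k : ℕ} (h : Route G ω u v d k) :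
    ∃ k' ≤ k, Level G ω (2 * Fintype.card V) u v d k' := by
  obtain ⟨L, h1, h2⟩ := h
  obtain ⟨L', s, hc, hw⟩ := h1.exists_le_card
  have hn : L'.length ≠ 0 := by simpa using hw.ne_nil
  rcases (h2.sublist (s.map ω) (by simpa using hw.ne_nil)).level hw rfl with
    ⟨k', hk, hl⟩ | ⟨e, k', hk, hl⟩
  · exact ⟨k', hk, hl.mono (by simp; omega)⟩
  · exact ⟨k' + 1, hk, (hl.recolour d).mono (by simp; omega)⟩

/-- Recolouring each vertex of a path separately suffices. This justifies `n` as the initial value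
of every table entry. -/
theorem Route.card [Fintype V] (hG : G.Connected) (ω : V → C) (u v : V) (d : C) :
    Route G ω u v d (Fintype.card V) := by
  obtain ⟨p⟩ := hG.preconnected u v
  obtain ⟨L, -, hc, hw⟩ := (isWalk_support p).exists_le_card
  exact ⟨L, hw, (Floods.length (by simpa using hw.ne_nil)).mono (by simpa using hc)⟩

end Moves
-- Total correctness and running time of programs
section Machine

/-- Started in `s`, the program `P` halts within `T` steps in a state satisfying `Q`. -/
def Runs (W : ℕ) (P : Prog) (s : State) (T : ℕ) (Q : State → Prop) : Prop :=
  ∃ s' t, Exec W P s s' t ∧ t ≤ T ∧ Q s'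

variable {W : ℕ} {P P' : Prog} {s : State} {T T' : ℕ} {Q R : State → Prop}

theorem Runs.weaken (h : Runs W P s T Q) (hT : T ≤ T') (hQ : ∀ s', Q s' → R s') :
    Runs W P s T' R := by
  obtain ⟨s', t, h1, h2, h3⟩ := h
  exact ⟨s', t, h1, h2.trans hT, hQ _ h3⟩

theorem Runs.seq (h : Runs W P s T Q) (h' : ∀ s', Q s' → Runs W P' s' T' R) :
    Runs W (.seq P P') s (T + T') R := by
  obtain ⟨s', t, h1, h2, h3⟩ := h
  obtain ⟨s'', t', h1', h2', h3'⟩ := h' s' h3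
  exact ⟨s'', t + t', .seq h1 h1', by omega, h3'⟩

theorem Runs.skip (h : Q s) : Runs W .skip s 1 Q := ⟨s, 1, .skip s, le_rfl, h⟩

theorem Runs.const {r k : ℕ} (hk : k ≤ W) (h : Q ⟨Function.update s.reg r k, s.mem⟩) :
    Runs W (.const r k) s 1 Q := ⟨_, 1, .const s r k hk, le_rfl, h⟩

theorem Runs.arith {f : Arith} {r a b : ℕ} (hk : f.eval (s.reg a) (s.reg b) ≤ W)
    (h : Q ⟨Function.update s.reg r (f.eval (s.reg a) (s.reg b)), s.mem⟩) :
    Runs W (.arith f r a b) s 1 Q := ⟨_, 1, .arith s f r a b hk, le_rfl, h⟩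

theorem Runs.load {r a : ℕ} (hk : s.mem (s.reg a) ≤ W)
    (h : Q ⟨Function.update s.reg r (s.mem (s.reg a)), s.mem⟩) :
    Runs W (.load r a) s 1 Q := ⟨_, 1, .load s r a hk, le_rfl, h⟩

theorem Runs.store {a r : ℕ} (h : Q ⟨s.reg, Function.update s.mem (s.reg a) (s.reg r)⟩) :
    Runs W (.store a r) s 1 Q := ⟨_, 1, .store s a r, le_rfl, h⟩

theorem Runs.ifLt {a b : ℕ} (h : s.reg a < s.reg b → Runs W P s T Q)
    (h' : ¬ s.reg a < s.reg b → Runs W P' s T Q) : Runs W (.ifLt a b P P') s (T + 1) Q := by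
  by_cases hlt : s.reg a < s.reg b
  · obtain ⟨s', t, h1, h2, h3⟩ := h hlt
    exact ⟨s', t + 1, .ifTrue hlt h1, by omega, h3⟩
  · obtain ⟨s', t, h1, h2, h3⟩ := h' hlt
    exact ⟨s', t + 1, .ifFalse hlt h1, by omega, h3⟩

/-- The registers below `i` agree. -/
def Keeps (i : ℕ) (s s' : State) : Prop := ∀ r < i, s'.reg r = s.reg r

theorem Keeps.trans {i : ℕ} {s s' s'' : State} (h : Keeps i s s') (h' : Keeps i s' s'') :
    Keeps i s s'' := fun r hr => (h' r hr).trans (h r hr)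

theorem Keeps.mono {i j : ℕ} {s s' : State} (h : Keeps j s s') (hij : i ≤ j) : Keeps i s s' :=
  fun r hr => h r (hr.trans_le hij)

/-- Run `P` with register `i` equal to `0`, `1`, … up to `reg[b] - 1`; register 1 must hold one. -/
def Prog.forLt (i b : ℕ) (P : Prog) : Prog :=
  .seq (.const i 0) (.whileLt i b (.seq P (.arith .add i i 1)))

/-- The body's time is written `x * t` so that nesting multiplies the factors `N` and merely adds
`4` to the constant: the loop takes at most `N * (x * t + 2) + 2` steps, and `N * x ≥ 1` absorbs the
overhead. -/
theorem Runs.forLt {i b N t x : ℕ} (hi : 1 < i) (hb : b < i) (hN : 1 ≤ N) (hx : 1 ≤ x)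
    (hNW : N ≤ W) (Φ : ℕ → (ℕ → ℕ) → Prop) (h1 : s.reg 1 = 1) (hsb : s.reg b = N)
    (h0 : Φ 0 s.mem)
    (hP : ∀ j < N, ∀ s', Keeps i s s' → s'.reg i = j → Φ j s'.mem →
      Runs W P s' (x * t) (fun s'' => Keeps (i + 1) s' s'' ∧ Φ (j + 1) s''.mem)) :
    Runs W (.forLt i b P) s (N * x * (t + 4)) (fun s' => Keeps i s s' ∧ Φ N s'.mem) := by
  have key : ∀ k j, j + k = N → ∀ s', Keeps i s s' → s'.reg i = j → Φ j s'.mem →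
      Runs W (.whileLt i b (.seq P (.arith .add i i 1))) s' (k * (x * t + 2) + 1)
        (fun s' => Keeps i s s' ∧ Φ N s'.mem) := by
    intro k
    induction k with
    | zero =>
      intro j hj s' hk hij hΦ
      refine ⟨s', 1, .whileFalse ?_, by omega, hk, ?_⟩
      · rw [hij, hk b hb, hsb]; omega
      · obtain rfl : j = N := by omega
        exact hΦ
    | succ k ih =>
      intro j hj s' hk hij hΦ
      obtain ⟨s₁, t₁, e₁, ht₁, hk₁, hΦ₁⟩ := hP j (by omega) s' hk hij hΦ
      have hi₁ : s₁.reg i = j := (hk₁ i (by omega)).trans hij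
      have h11 : s₁.reg 1 = 1 := ((hk₁ 1 (by omega)).trans (hk 1 hi)).trans h1
      have hev : Arith.eval .add (s₁.reg i) (s₁.reg 1) = j + 1 := by
        rw [hi₁, h11]; rfl
      have e₂ := Exec.arith (W := W) s₁ .add i i 1 (by rw [hev]; omega)
      rw [hev] at e₂
      obtain ⟨s₂, t₂, e₃, ht₂, hQ⟩ := ih (j + 1) (by omega)
        ⟨Function.update s₁.reg i (j + 1), s₁.mem⟩
        (fun r hr => by
          have := hk₁ r (by omega)
          simp [Function.update_of_ne (show r ≠ i by omega), this, hk r hr])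
        (by simp) hΦ₁
      refine ⟨s₂, _, .whileTrue ?_ (.seq e₁ e₂) e₃, ?_, hQ⟩
      · rw [hij, hk b hb, hsb]; omega
      · rw [Nat.succ_mul]; omega
  have h := key N 0 (by omega) ⟨Function.update s.reg i 0, s.mem⟩
    (fun r hr => by simp [Function.update_of_ne (show r ≠ i by omega)]) (by simp) h0
  have hs : Runs W (.const i 0) s 1 (fun s' => s' = ⟨Function.update s.reg i 0, s.mem⟩) :=
    .const (Nat.zero_le _) rfl
  refine (hs.seq (T' := N * (x * t + 2) + 1) ?_).weaken ?_ (fun _ h => h)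
  · rintro _ rfl; exact h
  · have : 1 ≤ N * x := Nat.mul_pos hN hx
    nlinarith [Nat.mul_le_mul_left N hx]

/-- A loop each of whose passes establishes a fact that later passes do not destroy. -/
theorem Runs.forLt_of_mono {i b N t x : ℕ} (hi : 1 < i) (hb : b < i) (hN : 1 ≤ N) (hx : 1 ≤ x)
    (hNW : N ≤ W) (Good : (ℕ → ℕ) → Prop) (Le : (ℕ → ℕ) → (ℕ → ℕ) → Prop)
    (Fact : ℕ → (ℕ → ℕ) → Prop)
    (hrefl : ∀ m, Le m m) (htrans : ∀ m m' m'', Le m m' → Le m' m'' → Le m m'')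
    (hFact : ∀ j m m', Le m m' → Fact j m → Fact j m')
    (h1 : s.reg 1 = 1) (hsb : s.reg b = N) (h0 : Good s.mem)
    (hP : ∀ j < N, ∀ s', Keeps i s s' → s'.reg i = j → Good s'.mem →
      Runs W P s' (x * t) (fun s'' => Keeps (i + 1) s' s'' ∧
        Good s''.mem ∧ Le s'.mem s''.mem ∧ Fact j s''.mem)) :
    Runs W (.forLt i b P) s (N * x * (t + 4)) (fun s' => Keeps i s s' ∧
      Good s'.mem ∧ Le s.mem s'.mem ∧ ∀ j < N, Fact j s'.mem) := by
  refine Runs.forLt hi hb hN hx hNW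
    (fun j m => Good m ∧ Le s.mem m ∧ ∀ j' < j, Fact j' m) h1 hsb
    ⟨h0, hrefl _, by simp⟩ ?_
  rintro j hj s' hk hij ⟨hg, hl, hf⟩
  refine (hP j hj s' hk hij hg).weaken le_rfl ?_
  rintro s'' ⟨a, b, c, d⟩
  refine ⟨a, b, htrans _ _ _ hl c, fun j' hj' => ?_⟩
  rcases Nat.lt_succ_iff_lt_or_eq.1 hj' with h | rfl
  · exact hFact _ _ _ c (hf _ h)
  · exact d

/-- `reg[t] := reg[6] + (reg[a] * reg[2] + reg[b]) * reg[3] + reg[d]`. -/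
def Prog.addr (t a b d : ℕ) : Prog :=
  .seq (.arith .mul t a 2) <| .seq (.arith .add t t b) <| .seq (.arith .mul t t 3) <|
    .seq (.arith .add t t d) (.arith .add t t 6)

/-- The position of the entry `(u, v, d)` of the table. -/
def pos (n c B u v d : ℕ) : ℕ := (u * n + v) * c + d + B

theorem Runs.addr {t a b d n c B u v e : ℕ} (ht : 6 < t) (hbt : b ≠ t) (hdt : d ≠ t)
    (h2 : s.reg 2 = n) (h3 : s.reg 3 = c) (h6 : s.reg 6 = B) (ha : s.reg a = u)
    (hb : s.reg b = v) (hd : s.reg d = e) (hc : 1 ≤ c) (hW : pos n c B u v e ≤ W)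
    (hQ : Q ⟨Function.update s.reg t (pos n c B u v e), s.mem⟩) :
    Runs W (.addr t a b d) s 5 Q := by
  -- With `1 ≤ c` all intermediate values lie below the final address, so the word bound for the
  -- address covers them.
  have e0 : u * n + v ≤ (u * n + v) * c := Nat.le_mul_of_pos_right _ hc
  unfold pos at hW hQ
  have n2 : (3 : ℕ) ≠ t := by omega
  have n3 : (6 : ℕ) ≠ t := by omega
  refine (Runs.seq (T := 1) (T' := 4) (Q := fun s' => s' = ⟨Function.update s.reg t (u * n), s.mem⟩)
    (.arith ?_ ?_) ?_)
  · simp only [Arith.eval, ha, h2]; omega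
  · simp only [Arith.eval, ha, h2]
  rintro _ rfl
  refine (Runs.seq (T := 1) (T' := 3)
    (Q := fun s' => s' = ⟨Function.update s.reg t (u * n + v), s.mem⟩) (.arith ?_ ?_) ?_)
  · simp only [Arith.eval, Function.update_self, Function.update_of_ne hbt, hb]; omega
  · simp only [Arith.eval, Function.update_self, Function.update_of_ne hbt, hb,
      Function.update_idem]
  rintro _ rfl
  refine (Runs.seq (T := 1) (T' := 2)
    (Q := fun s' => s' = ⟨Function.update s.reg t ((u * n + v) * c), s.mem⟩) (.arith ?_ ?_) ?_)
  · simp only [Arith.eval, Function.update_self, Function.update_of_ne n2, h3]; omega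
  · simp only [Arith.eval, Function.update_self, Function.update_of_ne n2, h3,
      Function.update_idem]
  rintro _ rfl
  refine (Runs.seq (T := 1) (T' := 1)
    (Q := fun s' => s' = ⟨Function.update s.reg t ((u * n + v) * c + e), s.mem⟩) (.arith ?_ ?_) ?_)
  · simp only [Arith.eval, Function.update_self, Function.update_of_ne hdt, hd]; omega
  · simp only [Arith.eval, Function.update_self, Function.update_of_ne hdt, hd,
      Function.update_idem]
  rintro _ rfl
  refine .arith ?_ ?_
  · simp only [Arith.eval, Function.update_self, Function.update_of_ne n3, h6]; omega
  · simpa only [Arith.eval, Function.update_self, Function.update_of_ne n3, h6,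
      Function.update_idem] using hQ

/-- Addresses are mixed-radix expansions with digits below `n` and `c`. -/
theorem pos_inj {n c B u v d u' v' d' : ℕ} (hv : v < n) (hv' : v' < n) (hd : d < c) (hd' : d' < c)
    (h : pos n c B u v d = pos n c B u' v' d') : u = u' ∧ v = v' ∧ d = d' := by
  have aux : ∀ {a b q r r' : ℕ}, r < q → r' < q → a * q + r = b * q + r' → a = b ∧ r = r' := by
    intro a b q r r' hr hr' h
    have hq : 0 < q := by omega
    have h1 := congrArg (· / q) h
    have h2 := congrArg (· % q) h
    simp only [Nat.mul_add_mod', Nat.mod_eq_of_lt hr, Nat.mod_eq_of_lt hr'] at h2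
    rw [← h2] at h
    exact ⟨Nat.eq_of_mul_eq_mul_right hq (by omega), h2⟩
  unfold pos at h
  obtain ⟨h1, h2⟩ := aux hd hd' (Nat.add_right_cancel h)
  obtain ⟨h3, h4⟩ := aux hv hv' h1
  exact ⟨h3, h4, h2⟩

theorem pos_le {n c B u v d : ℕ} (hu : u < n) (hv : v < n) (hd : d < c) :
    pos n c B u v d < n * n * c + B := by
  unfold pos
  have h1 : u * n + v + 1 ≤ n * n := by nlinarith
  nlinarith

end Machine
-- Relaxing one table entry
section Program

/-- The contents of the registers that hold constants. -/
structure Env (n c m B : ℕ) (s : State) : Prop where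
  r0 : s.reg 0 = 0
  r1 : s.reg 1 = 1
  r2 : s.reg 2 = n
  r3 : s.reg 3 = c
  r4 : s.reg 4 = m
  r5 : s.reg 5 = n + 3
  r6 : s.reg 6 = B
  r7 : s.reg 7 = 2 * n

theorem Env.keeps {n c m B i : ℕ} {s s' : State} (h : Env n c m B s) (hk : Keeps i s s')
    (hi : 8 ≤ i) : Env n c m B s' := by
  obtain ⟨h0, h1, h2, h3, h4, h5, h6, h7⟩ := h
  constructor <;> rw [hk _ (by omega)] <;> assumption

variable {n c : ℕ} {G : SimpleGraph (Fin n)} {ω : Fin n → Fin c} {es : List (Fin n × Fin n)}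
  {B W : ℕ}

/-- The colours and the edges stand where the encoding puts them. -/
structure Input (ω : Fin n → Fin c) (es : List (Fin n × Fin n)) (m : ℕ → ℕ) : Prop where
  colours : ∀ v : Fin n, m (3 + v) = ω v
  edges : ∀ (e : ℕ) (x y : Fin n), es[e]? = some (x, y) →
    m (n + 3 + 2 * e) = x ∧ m (n + 3 + 2 * e + 1) = y

/-- Every entry of the table is the cost of some route. -/
structure Good (G : SimpleGraph (Fin n)) (ω : Fin n → Fin c) (es : List (Fin n × Fin n)) (B : ℕ)
    (m : ℕ → ℕ) : Prop where
  input : Input ω es m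
  route : ∀ (u v : Fin n) (d : Fin c), Route G ω u v d (m (pos n c B u v d))
  le : ∀ (u v : Fin n) (d : Fin c), m (pos n c B u v d) ≤ n

/-- No cell from `B` on has increased. -/
def TLe (B : ℕ) (m m' : ℕ → ℕ) : Prop := ∀ a, B ≤ a → m' a ≤ m a

theorem TLe.refl (B : ℕ) (m : ℕ → ℕ) : TLe B m m := fun _ _ => le_rfl

theorem TLe.trans {m m' m'' : ℕ → ℕ} (h : TLe B m m') (h' : TLe B m' m'') : TLe B m m'' :=
  fun a ha => (h' a ha).trans (h a ha)

theorem le_pos (n c B u v d : ℕ) : B ≤ pos n c B u v d := Nat.le_add_left _ _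

theorem Input.update {m : ℕ → ℕ} (h : Input ω es m) (hB : n + 3 + 2 * es.length ≤ B) {a k : ℕ}
    (ha : B ≤ a) : Input ω es (Function.update m a k) := by
  constructor
  · intro v
    rw [Function.update_of_ne (by have := v.2; omega)]
    exact h.colours v
  · intro e x y he
    have := (List.getElem?_eq_some_iff.1 he).1
    rw [Function.update_of_ne (by omega), Function.update_of_ne (by omega)]
    exact h.edges e x y he

theorem Good.update {m : ℕ → ℕ} (h : Good G ω es B m) (hB : n + 3 + 2 * es.length ≤ B)
    {u v : Fin n} {d : Fin c} {k : ℕ} (hk : k ≤ m (pos n c B u v d)) (hr : Route G ω u v d k) :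
    Good G ω es B (Function.update m (pos n c B u v d) k) ∧
      TLe B m (Function.update m (pos n c B u v d) k) := by
  refine ⟨⟨h.input.update hB (le_pos ..), ?_, ?_⟩, ?_⟩
  · intro u' v' d'
    rw [Function.update_apply]
    split_ifs with he
    · obtain ⟨h1, h2, h3⟩ := pos_inj v'.2 v.2 d'.2 d.2 he
      obtain rfl := Fin.ext h1
      obtain rfl := Fin.ext h2
      obtain rfl := Fin.ext h3
      exact hr
    · exact h.route u' v' d'
  · intro u' v' d'
    rw [Function.update_apply]
    split_ifs
    · exact hk.trans (h.le u v d)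
    · exact h.le u' v' d'
  · intro a _
    rw [Function.update_apply]
    split_ifs with he
    · rwa [he]
    · exact le_rfl

/-- `reg[15] := min reg[15] reg[16]`; register 0 must hold zero. -/
def Prog.min : Prog := .ifLt 16 15 (.arith .add 15 16 0) .skip

theorem Runs.min {s : State} (h0 : s.reg 0 = 0) (hW : s.reg 16 ≤ W) :
    Runs W .min s 2 (fun s' => s'.mem = s.mem ∧ (∀ r, r ≠ 15 → s'.reg r = s.reg r) ∧
      s'.reg 15 = Min.min (s.reg 15) (s.reg 16)) := by
  refine .ifLt (fun hlt => .arith ?_ ?_) (fun hlt => .skip ?_)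
  · simpa [Arith.eval, h0] using hW
  · refine ⟨rfl, fun r hr => by simp [Function.update_of_ne hr], ?_⟩
    simp [Arith.eval, h0]; omega
  · exact ⟨rfl, fun _ _ => rfl, by omega⟩

/-- `reg[t] := table[reg[a], reg[b], reg[d]]`. -/
def Prog.look (t a b d : ℕ) : Prog := .seq (.addr t a b d) (.load t t)

theorem Runs.look {s : State} {m t a b d : ℕ} {u v : Fin n} {e : Fin c} (hs : Env n c m B s)
    (ht : 6 < t) (hbt : b ≠ t) (hdt : d ≠ t) (ha : s.reg a = u) (hb : s.reg b = v)
    (hd : s.reg d = e) (hW : n * n * c + B ≤ W) (hm : s.mem (pos n c B u v e) ≤ W) :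
    Runs W (.look t a b d) s 6
      (fun s' => s' = ⟨Function.update s.reg t (s.mem (pos n c B u v e)), s.mem⟩) := by
  have hp := (pos_le (B := B) u.2 v.2 e.2)
  refine Runs.seq (T := 5) (T' := 1)
    (Q := fun s' => s' = ⟨Function.update s.reg t (pos n c B u v e), s.mem⟩)
    (.addr ht hbt hdt hs.r2 hs.r3 hs.r6 ha hb hd (by have := e.2; omega) (by omega) rfl) ?_
  rintro _ rfl
  refine .load ?_ ?_
  · simpa using hm
  · simp

/-- `reg[16] := table[reg[9], reg[a], reg[11]] + table[reg[b], reg[10], reg[11]]`. -/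
def Prog.candidate (a b : ℕ) : Prog :=
  .seq (.look 16 9 a 11) <| .seq (.look 17 b 10 11) (.arith .add 16 16 17)

theorem Runs.candidate {s : State} {m a b : ℕ} {u v x y : Fin n} {d : Fin c}
    (hs : Env n c m B s) (hg : Good G ω es B s.mem) (ha : a ≠ 16) (hb : b ≠ 16)
    (h9 : s.reg 9 = u) (h10 : s.reg 10 = v) (h11 : s.reg 11 = d) (hx : s.reg a = x)
    (hy : s.reg b = y) (hW : n * n * c + B + 2 * n ≤ W) :
    Runs W (.candidate a b) s 13 (fun s' => s'.mem = s.mem ∧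
      (∀ r, r ≠ 16 → r ≠ 17 → s'.reg r = s.reg r) ∧
      s'.reg 16 = s.mem (pos n c B u x d) + s.mem (pos n c B y v d)) := by
  have l1 := hg.le u x d
  have l2 := hg.le y v d
  refine Runs.seq (T := 6) (T' := 7) (.look hs (by omega) ha (by omega) h9 hx h11 (by omega)
    (by omega)) ?_
  rintro _ rfl
  refine Runs.seq (T := 6) (T' := 1) (.look (B := B) (u := y) (v := v) (e := d) (m := m) ?_ (by omega)
    (by omega) (by omega) ?_ ?_ ?_ (by omega) (by simp only; omega)) ?_
  · exact hs.keeps (i := 8) (fun r hr => by simp [Function.update_of_ne (show r ≠ 16 by omega)])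
      le_rfl
  · simpa [Function.update_of_ne hb] using hy
  · simpa using h10
  · simpa using h11
  rintro _ rfl
  refine .arith ?_ ⟨rfl, ?_, ?_⟩
  · simp [Arith.eval]; omega
  · intro r h1 h2
    simp [Function.update_of_ne h1, Function.update_of_ne h2]
  · simp [Arith.eval]

/-- `reg[16] := table[reg[9], reg[10], reg[13]] + 1`. -/
def Prog.recolouring : Prog := .seq (.look 16 9 10 13) (.arith .add 16 16 1)

theorem Runs.recolouring {s : State} {m : ℕ} {u v : Fin n} {d : Fin c} (hs : Env n c m B s)
    (hg : Good G ω es B s.mem) (h9 : s.reg 9 = u) (h10 : s.reg 10 = v) (h13 : s.reg 13 = d)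
    (hW : n * n * c + B + 2 * n ≤ W) :
    Runs W .recolouring s 7 (fun s' => s'.mem = s.mem ∧
      (∀ r, r ≠ 16 → s'.reg r = s.reg r) ∧ s'.reg 16 = s.mem (pos n c B u v d) + 1) := by
  have l1 := hg.le u v d
  have := u.2
  refine Runs.seq (T := 6) (T' := 1) (.look hs (by omega) (by omega) (by omega) h9 h10 h13
    (by omega) (by omega)) ?_
  rintro _ rfl
  refine .arith ?_ ⟨rfl, ?_, ?_⟩
  · simp [Arith.eval, hs.r1]; omega
  · intro r h1
    simp [Function.update_of_ne h1]
  · simp [Arith.eval, hs.r1]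

/-- Load the ends of edge `reg[12]` into registers 18 and 19. -/
def Prog.ends : Prog :=
  .seq (.arith .add 17 12 12) <| .seq (.arith .add 17 17 5) <| .seq (.load 18 17) <|
    .seq (.arith .add 17 17 1) (.load 19 17)

theorem Runs.ends {s : State} {m e : ℕ} {x y : Fin n} (hs : Env n c m B s)
    (hg : Input ω es s.mem) (h12 : s.reg 12 = e) (he : es[e]? = some (x, y))
    (hB : n + 3 + 2 * es.length ≤ B) (hW : B ≤ W) :
    Runs W .ends s 5 (fun s' => s'.mem = s.mem ∧ (∀ r < 17, s'.reg r = s.reg r) ∧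
      s'.reg 18 = x ∧ s'.reg 19 = y) := by
  have hl := (List.getElem?_eq_some_iff.1 he).1
  obtain ⟨hx, hy⟩ := hg.edges e x y he
  have x2 := x.2
  have y2 := y.2
  have e1 : e + e + (n + 3) = n + 3 + 2 * e := by ring
  refine Runs.seq (T := 1) (T' := 4)
    (Q := fun s' => s' = ⟨Function.update s.reg 17 (e + e), s.mem⟩) (.arith ?_ ?_) ?_
  · simp only [Arith.eval, h12]; omega
  · simp only [Arith.eval, h12]
  rintro _ rfl
  refine Runs.seq (T := 1) (T' := 3)
    (Q := fun s' => s' = ⟨Function.update s.reg 17 (n + 3 + 2 * e), s.mem⟩) (.arith ?_ ?_) ?_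
  · simp [Arith.eval, hs.r5]; omega
  · simp [Arith.eval, hs.r5, e1]
  rintro _ rfl
  refine Runs.seq (T := 1) (T' := 2)
    (Q := fun s' => s' = ⟨Function.update (Function.update s.reg 17 (n + 3 + 2 * e)) 18 x, s.mem⟩)
    (.load ?_ ?_) ?_
  · simp [hx]; omega
  · simp [hx]
  rintro _ rfl
  refine Runs.seq (T := 1) (T' := 1)
    (Q := fun s' => s'.mem = s.mem ∧ (∀ r < 17, s'.reg r = s.reg r) ∧
      s'.reg 18 = x ∧ s'.reg 17 = n + 3 + 2 * e + 1)
    (.arith ?_ ⟨rfl, fun r hr => ?_, ?_, ?_⟩) ?_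
  · simp [Arith.eval, hs.r1]; omega
  · simp [Function.update_of_ne (show r ≠ 17 by omega), Function.update_of_ne (show r ≠ 18 by omega)]
  · simp
  · simp [Arith.eval, hs.r1]
  rintro s' ⟨h1, h2, h3, h4⟩
  refine .load ?_ ⟨h1, fun r hr => ?_, ?_, ?_⟩
  · rw [h1, h4, hy]; omega
  · simp [Function.update_of_ne (show r ≠ 19 by omega), h2 r hr]
  · simpa using h3
  · simp [h1, h4, hy]

/-- Improve `table[reg[9], reg[10], reg[11]]` by recolouring a route of colour `reg[13]` and by
concatenating routes across the edge `reg[12]`. -/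
def Prog.relax : Prog :=
  .seq (.look 15 9 10 11) <| .seq .recolouring <| .seq .min <| .seq .ends <|
    .seq (.candidate 18 19) <| .seq .min <| .seq (.candidate 19 18) <| .seq .min <|
      .seq (.addr 14 9 10 11) (.store 14 15)

/-- The entry `(u, v, d)` of `m'` is at most what the entries of `m` yield using the colour `d'`
and the edge number `e`. -/
def Relaxed (c : ℕ) (es : List (Fin n × Fin n)) (B : ℕ) (m : ℕ → ℕ) (u v d e d' : ℕ)
    (m' : ℕ → ℕ) : Prop :=
  m' (pos n c B u v d) ≤ m (pos n c B u v d') + 1 ∧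
    ∀ x y : Fin n, es[e]? = some (x, y) →
      m' (pos n c B u v d) ≤ m (pos n c B u x d) + m (pos n c B y v d) ∧
      m' (pos n c B u v d) ≤ m (pos n c B u y d) + m (pos n c B x v d)

theorem Relaxed.anti {m m₁ m₂ : ℕ → ℕ} {u v d e d' : ℕ} (h : Relaxed c es B m u v d e d' m₁)
    (hl : TLe B m₁ m₂) : Relaxed c es B m u v d e d' m₂ := by
  have := hl _ (le_pos n c B u v d)
  exact ⟨this.trans h.1, fun x y he => ⟨this.trans (h.2 x y he).1, this.trans (h.2 x y he).2⟩⟩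

theorem Relaxed.weaken {m m₁ m₂ : ℕ → ℕ} {u v d e d' : ℕ} (h : Relaxed c es B m₁ u v d e d' m₂)
    (hl : TLe B m m₁) : Relaxed c es B m u v d e d' m₂ :=
  ⟨h.1.trans (Nat.add_le_add_right (hl _ (le_pos ..)) 1), fun x y he =>
    ⟨(h.2 x y he).1.trans (Nat.add_le_add (hl _ (le_pos ..)) (hl _ (le_pos ..))),
      (h.2 x y he).2.trans (Nat.add_le_add (hl _ (le_pos ..)) (hl _ (le_pos ..)))⟩⟩

/-- Register 15 collects the minimum of the old entry, the recolouring, and the concatenations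
across the edge in both orientations, as the list holds each edge only once. Each candidate is the
cost of a route, so the invariant `Good` survives the write. -/
theorem Runs.relax {s : State} {e : ℕ} {u v : Fin n} {d d' : Fin c}
    (hes : ∀ x y, (x, y) ∈ es → G.Adj x y) (hB : n + 3 + 2 * es.length ≤ B)
    (hW : n * n * c + B + 2 * n ≤ W)
    (hs : Env n c es.length B s) (hg : Good G ω es B s.mem)
    (h9 : s.reg 9 = u) (h10 : s.reg 10 = v) (h11 : s.reg 11 = d) (h12 : s.reg 12 = e)
    (he : e < es.length) (h13 : s.reg 13 = d') :
    Runs W .relax s 56 (fun s' => Keeps 14 s s' ∧ Good G ω es B s'.mem ∧ TLe B s.mem s'.mem ∧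
      Relaxed c es B s.mem u v d e d' s'.mem) := by
  obtain ⟨⟨x, y⟩, hxy⟩ : ∃ p, es[e]? = some p := ⟨_, List.getElem?_eq_getElem he⟩
  have hadj : G.Adj x y := hes x y (List.mem_of_getElem? hxy)
  have l1 := hg.le u v d
  have l2 := hg.le u v d'
  have l3 := hg.le u x d
  have l4 := hg.le y v d
  have l5 := hg.le u y d
  have l6 := hg.le x v d
  have hn := u.2
  refine Runs.seq (T := 6) (T' := 50) (.look hs (by omega) (by omega) (by omega) h9 h10 h11
    (by omega) (by omega)) ?_
  rintro _ rfl
  set A := s.mem (pos n c B u v d) with hA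
  obtain ⟨s₁, hs₁⟩ : ∃ s₁ : State, s₁ = ⟨Function.update s.reg 15 A, s.mem⟩ := ⟨_, rfl⟩
  rw [← hs₁]
  have m₁ : s₁.mem = s.mem := by rw [hs₁]
  have k₁ : Keeps 15 s s₁ := fun r hr => by
    rw [hs₁]; simp [Function.update_of_ne (show r ≠ 15 by omega)]
  have v₁ : s₁.reg 15 = A := by simp [hs₁]
  have reg : ∀ {t : State} {r : ℕ}, Keeps 15 s t → r < 15 → t.reg r = s.reg r := fun h hr => h _ hr
  refine Runs.seq (T := 7) (T' := 43) (.recolouring (u := u) (v := v) (d := d') (m := es.length)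
    (hs.keeps k₁ (by omega)) (m₁ ▸ hg) (by rw [reg k₁ (by omega), h9])
    (by rw [reg k₁ (by omega), h10]) (by rw [reg k₁ (by omega), h13]) hW) ?_
  rintro s₂ ⟨m₂, f₂, v₂⟩
  rw [m₁] at m₂ v₂
  have k₂ : Keeps 15 s s₂ := k₁.trans fun r hr => f₂ r (by omega)
  refine Runs.seq (T := 2) (T' := 41) (.min (by rw [reg k₂ (by omega), hs.r0])
    (by rw [v₂]; omega)) ?_
  rintro s₃ ⟨m₃, f₃, v₃⟩
  rw [m₂] at m₃
  rw [v₂, f₂ 15 (by omega), v₁] at v₃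
  have k₃ : Keeps 15 s s₃ := k₂.trans fun r hr => f₃ r (by omega)
  refine Runs.seq (T := 5) (T' := 36) (.ends (hs.keeps k₃ (by omega))
    (m₃ ▸ hg.input) (by rw [reg k₃ (by omega), h12]) hxy hB (by omega)) ?_
  rintro s₄ ⟨m₄, f₄, x₄, y₄⟩
  rw [m₃] at m₄
  have v₄ := (f₄ 15 (by omega)).trans v₃
  have k₄ : Keeps 15 s s₄ := k₃.trans fun r hr => f₄ r (by omega)
  refine Runs.seq (T := 13) (T' := 23) (.candidate (hs.keeps k₄ (by omega))
    (m₄ ▸ hg) (by omega) (by omega) (by rw [reg k₄ (by omega), h9])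
    (by rw [reg k₄ (by omega), h10]) (by rw [reg k₄ (by omega), h11]) x₄ y₄ hW) ?_
  rintro s₅ ⟨m₅, f₅, v₅⟩
  rw [m₄] at m₅ v₅
  have k₅ : Keeps 15 s s₅ := k₄.trans fun r hr => f₅ r (by omega) (by omega)
  refine Runs.seq (T := 2) (T' := 21) (.min (by rw [reg k₅ (by omega), hs.r0])
    (by rw [v₅]; omega)) ?_
  rintro s₆ ⟨m₆, f₆, v₆⟩
  rw [m₅] at m₆
  rw [v₅, f₅ 15 (by omega) (by omega), v₄] at v₆
  have k₆ : Keeps 15 s s₆ := k₅.trans fun r hr => f₆ r (by omega)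
  refine Runs.seq (T := 13) (T' := 8) (.candidate (x := y) (y := x) (hs.keeps k₆ (by omega))
    (m₆ ▸ hg) (by omega) (by omega) (by rw [reg k₆ (by omega), h9])
    (by rw [reg k₆ (by omega), h10]) (by rw [reg k₆ (by omega), h11])
    (by rw [f₆ _ (by omega), f₅ _ (by omega) (by omega), y₄])
    (by rw [f₆ _ (by omega), f₅ _ (by omega) (by omega), x₄]) hW) ?_
  rintro s₇ ⟨m₇, f₇, v₇⟩
  rw [m₆] at m₇ v₇
  have k₇ : Keeps 15 s s₇ := k₆.trans fun r hr => f₇ r (by omega) (by omega)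
  refine Runs.seq (T := 2) (T' := 6) (.min (by rw [reg k₇ (by omega), hs.r0])
    (by rw [v₇]; omega)) ?_
  rintro s₈ ⟨m₈, f₈, v₈⟩
  rw [m₇] at m₈
  rw [v₇, f₇ 15 (by omega) (by omega), v₆] at v₈
  have k₈ : Keeps 15 s s₈ := k₇.trans fun r hr => f₈ r (by omega)
  have hE := hs.keeps k₈ (by omega)
  have hp := pos_le (B := B) u.2 v.2 d.2
  refine Runs.seq (T := 5) (T' := 1)
    (Q := fun s' => s' = ⟨Function.update s₈.reg 14 (pos n c B u v d), s₈.mem⟩)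
    (.addr (by omega) (by omega) (by omega) hE.r2 hE.r3 hE.r6 (by rw [reg k₈ (by omega), h9])
      (by rw [reg k₈ (by omega), h10]) (by rw [reg k₈ (by omega), h11])
      (by have := d.2; omega) (by omega) rfl) ?_
  rintro _ rfl
  refine .store ?_
  simp only [Function.update_self, Function.update_of_ne (show (15 : ℕ) ≠ 14 by omega), m₈, v₈]
  set k := Min.min (Min.min (Min.min A (s.mem (pos n c B u v d') + 1))
    (s.mem (pos n c B u x d) + s.mem (pos n c B y v d)))
    (s.mem (pos n c B u y d) + s.mem (pos n c B x v d)) with hk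
  have hroute : Route G ω u v d k := by
    have r1 : Route G ω u v d A := hg.route u v d
    have r2 := (hg.route u v d').recolour d
    have r3 := (hg.route u x d).append hadj (hg.route y v d)
    have r4 := (hg.route u y d).append hadj.symm (hg.route x v d)
    rw [hk]
    rcases min_choice (Min.min (Min.min A (s.mem (pos n c B u v d') + 1))
      (s.mem (pos n c B u x d) + s.mem (pos n c B y v d)))
      (s.mem (pos n c B u y d) + s.mem (pos n c B x v d)) with h | h
    · rw [h]
      rcases min_choice (Min.min A (s.mem (pos n c B u v d') + 1))
        (s.mem (pos n c B u x d) + s.mem (pos n c B y v d)) with h | h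
      · rw [h]
        rcases min_choice A (s.mem (pos n c B u v d') + 1) with h | h <;> rw [h] <;> assumption
      · rwa [h]
    · rwa [h]
  obtain ⟨g1, g2⟩ := hg.update hB (k := k) (by omega) hroute
  refine ⟨fun r hr => ?_, g1, g2, ?_, ?_⟩
  · simp only [Function.update_of_ne (show r ≠ 14 by omega)]
    exact k₈ r (by omega)
  · rw [Function.update_self]; omega
  · intro x' y' he'
    obtain ⟨rfl, rfl⟩ : x = x' ∧ y = y' := by simpa [hxy] using he'
    rw [Function.update_self]; omega

end Program
-- Rounds, initialisation and output
section Phases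

variable {n c : ℕ} {G : SimpleGraph (Fin n)} {ω : Fin n → Fin c} {es : List (Fin n × Fin n)}
  {B W : ℕ}

/-- Improve every entry of the table in every way. -/
def Prog.round : Prog := .forLt 9 2 <| .forLt 10 2 <| .forLt 11 3 <| .forLt 12 4 <| .forLt 13 3 .relax

/-- Updates happen in place, so later passes read entries already lowered in this round. Entries
never increase, which makes this harmless: smaller inputs give stronger bounds (`Relaxed.weaken`),
and later decreases preserve them (`Relaxed.anti`). The constant is `56 + 5 * 4`, for five nested
loops. -/
theorem Runs.round {s : State} (hn : 1 ≤ n) (hc : 1 ≤ c) (hm : 1 ≤ es.length)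
    (hes : ∀ x y, (x, y) ∈ es → G.Adj x y) (hB : n + 3 + 2 * es.length ≤ B)
    (hW : n * n * c + B + 2 * n ≤ W) (hs : Env n c es.length B s) (hg : Good G ω es B s.mem) :
    Runs W .round s (n * (n * (c * (es.length * (c * 1)))) * 76) (fun s' => Keeps 9 s s' ∧
      Good G ω es B s'.mem ∧ TLe B s.mem s'.mem ∧ ∀ u < n, ∀ v < n, ∀ d < c, ∀ e < es.length,
        ∀ d' < c, Relaxed c es B s.mem u v d e d' s'.mem) := by
  have hnc : c ≤ n * n * c := Nat.le_mul_of_pos_left _ (Nat.mul_pos hn hn)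
  have p5 : 1 ≤ c * 1 := by omega
  have p4 : 1 ≤ es.length * (c * 1) := Nat.mul_pos hm p5
  have p3 : 1 ≤ c * (es.length * (c * 1)) := Nat.mul_pos hc p4
  have p2 : 1 ≤ n * (c * (es.length * (c * 1))) := Nat.mul_pos hn p3
  let Good' := fun m => Good G ω es B m ∧ TLe B s.mem m
  refine (Runs.forLt_of_mono (t := 72) (by omega) (by omega) hn p2 (by omega) Good' (TLe B)
    (fun u m => ∀ v < n, ∀ d < c, ∀ e < es.length, ∀ d' < c, Relaxed c es B s.mem u v d e d' m)
    (TLe.refl B) (fun _ _ _ => TLe.trans)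
    (fun j m m' hl h v hv d hd e he d' hd' => (h v hv d hd e he d' hd').anti hl)
    hs.r1 hs.r2 ⟨hg, TLe.refl _ _⟩ ?_).weaken le_rfl
      (fun s' h => ⟨h.1, h.2.1.1, h.2.2.1, h.2.2.2⟩)
  intro u hu s₁ k₁ h9 g₁
  have e₁ := hs.keeps k₁ (by omega)
  refine (Runs.forLt_of_mono (t := 68) (by omega) (by omega) hn p3 (by omega) Good' (TLe B)
    (fun v m => ∀ d < c, ∀ e < es.length, ∀ d' < c, Relaxed c es B s.mem u v d e d' m)
    (TLe.refl B) (fun _ _ _ => TLe.trans)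
    (fun j m m' hl h d hd e he d' hd' => (h d hd e he d' hd').anti hl)
    e₁.r1 e₁.r2 g₁ ?_)
  intro v hv s₂ k₂ h10 g₂
  have e₂ := e₁.keeps k₂ (by omega)
  refine (Runs.forLt_of_mono (t := 64) (by omega) (by omega) hc p4 (by omega) Good' (TLe B)
    (fun d m => ∀ e < es.length, ∀ d' < c, Relaxed c es B s.mem u v d e d' m)
    (TLe.refl B) (fun _ _ _ => TLe.trans)
    (fun j m m' hl h e he d' hd' => (h e he d' hd').anti hl)
    e₂.r1 e₂.r3 g₂ ?_)
  intro d hd s₃ k₃ h11 g₃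
  have e₃ := e₂.keeps k₃ (by omega)
  refine (Runs.forLt_of_mono (t := 60) (by omega) (by omega) hm p5 (by omega) Good' (TLe B)
    (fun e m => ∀ d' < c, Relaxed c es B s.mem u v d e d' m)
    (TLe.refl B) (fun _ _ _ => TLe.trans) (fun j m m' hl h d' hd' => (h d' hd').anti hl)
    e₃.r1 e₃.r4 g₃ ?_)
  intro e he s₄ k₄ h12 g₄
  have e₄ := e₃.keeps k₄ (by omega)
  refine (Runs.forLt_of_mono (t := 56) (by omega) (by omega) hc le_rfl (by omega) Good' (TLe B)
    (fun d' m => Relaxed c es B s.mem u v d e d' m)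
    (TLe.refl B) (fun _ _ _ => TLe.trans) (fun j m m' hl h => h.anti hl)
    e₄.r1 e₄.r3 g₄ ?_)
  intro d' hd' s₅ k₅ h13 g₅
  have e₅ := e₄.keeps k₅ (by omega)
  have q12 : s₅.reg 12 = e := (k₅ 12 (by omega)).trans h12
  have q11 : s₅.reg 11 = d := (k₅ 11 (by omega)).trans <| (k₄ 11 (by omega)).trans h11
  have q10 : s₅.reg 10 = v := (k₅ 10 (by omega)).trans <| (k₄ 10 (by omega)).trans <|
    (k₃ 10 (by omega)).trans h10
  have q9 : s₅.reg 9 = u := (k₅ 9 (by omega)).trans <| (k₄ 9 (by omega)).trans <|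
    (k₃ 9 (by omega)).trans <| (k₂ 9 (by omega)).trans h9
  refine (Runs.relax (u := ⟨u, hu⟩) (v := ⟨v, hv⟩) (d := ⟨d, hd⟩) (d' := ⟨d', hd'⟩) hes hB hW
    e₅ g₅.1 q9 q10 q11 q12 he h13).weaken (by omega) ?_
  rintro s' ⟨a, b, l, f⟩
  exact ⟨a, ⟨b, g₅.2.trans l⟩, l, f.weaken g₅.2⟩

/-- The table accounts for all routes of level `r`. -/
def Complete (G : SimpleGraph (Fin n)) (ω : Fin n → Fin c) (B r : ℕ) (m : ℕ → ℕ) : Prop :=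
  ∀ (u v : Fin n) (d : Fin c) (k : ℕ), Level G ω r u v d k → m (pos n c B u v d) ≤ k

/-- One round performs every possible last step of a route of the next level. -/
theorem Complete.succ {r : ℕ} {m m' : ℕ → ℕ} (h : Complete G ω B r m) (hl : TLe B m m')
    (hm : 1 ≤ es.length)
    (hes : ∀ x y, G.Adj x y → (x, y) ∈ es ∨ (y, x) ∈ es)
    (hr : ∀ u < n, ∀ v < n, ∀ d < c, ∀ e < es.length, ∀ d' < c, Relaxed c es B m u v d e d' m') :
    Complete G ω B (r + 1) m' := by
  intro u v d k hk
  cases hk with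
  | refl => exact (hl _ (le_pos ..)).trans (h u u _ 0 (.refl r u))
  | @recolour _ _ _ d₀ k _ h₀ =>
    -- Recolouring does not depend on the edge; edge `0` is an arbitrary choice, available by `hm`.
    exact (hr u u.2 v v.2 d d.2 0 hm d₀ d₀.2).1.trans (Nat.add_le_add_right (h _ _ _ _ h₀) 1)
  | @append _ _ _ x y _ k k' h₁ hxy h₂ =>
    rcases hes x y hxy with he | he
    · obtain ⟨e, he, hxy⟩ := List.getElem_of_mem he
      exact ((hr u u.2 v v.2 d d.2 e he d d.2).2 x y
        (List.getElem?_eq_some_iff.2 ⟨he, hxy⟩)).1.trans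
        (Nat.add_le_add (h _ _ _ _ h₁) (h _ _ _ _ h₂))
    · obtain ⟨e, he, hxy⟩ := List.getElem_of_mem he
      exact ((hr u u.2 v v.2 d d.2 e he d d.2).2 y x
        (List.getElem?_eq_some_iff.2 ⟨he, hxy⟩)).2.trans
        (Nat.add_le_add (h _ _ _ _ h₁) (h _ _ _ _ h₂))

theorem Runs.rounds {s : State} (hn : 1 ≤ n) (hc : 1 ≤ c) (hm : 1 ≤ es.length)
    (hes : ∀ x y, (x, y) ∈ es → G.Adj x y) (hes' : ∀ x y, G.Adj x y → (x, y) ∈ es ∨ (y, x) ∈ es)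
    (hB : n + 3 + 2 * es.length ≤ B)
    (hW : n * n * c + B + 2 * n ≤ W) (hs : Env n c es.length B s) (hg : Good G ω es B s.mem)
    (h0 : Complete G ω B 0 s.mem) :
    Runs W (.forLt 8 7 .round) s (2 * n * (n * (n * (c * (es.length * (c * 1))))) * 80)
      (fun s' => Keeps 8 s s' ∧ Good G ω es B s'.mem ∧ Complete G ω B (2 * n) s'.mem) := by
  have p : 1 ≤ n * (n * (c * (es.length * (c * 1)))) :=
    Nat.mul_pos hn (Nat.mul_pos hn (Nat.mul_pos hc (Nat.mul_pos hm (by omega))))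
  refine Runs.forLt (t := 76) (by omega) (by omega) (by omega) p (by omega)
    (fun j m => Good G ω es B m ∧ Complete G ω B j m) hs.r1 hs.r7 ⟨hg, h0⟩ ?_
  rintro j hj s' hk h8 ⟨g, hcp⟩
  refine (Runs.round hn hc hm hes hB hW (hs.keeps hk le_rfl) g).weaken le_rfl ?_
  rintro s'' ⟨a, b, l, f⟩
  exact ⟨a, b, hcp.succ l hm hes' f⟩

/-- Fill the table with `n`. -/
def Prog.fill : Prog :=
  .forLt 9 2 <| .forLt 10 2 <| .forLt 11 3 <| .seq (.addr 14 9 10 11) (.store 14 2)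

theorem Runs.fill {s : State} (hn : 1 ≤ n) (hc : 1 ≤ c) (hB : n + 3 + 2 * es.length ≤ B)
    (hW : n * n * c + B + 2 * n ≤ W) (hs : Env n c es.length B s) (hg : Input ω es s.mem) :
    Runs W .fill s (n * (n * (c * 1)) * 18) (fun s' => Keeps 9 s s' ∧
      Input ω es s'.mem ∧ ∀ u < n, ∀ v < n, ∀ d < c, s'.mem (pos n c B u v d) = n) := by
  have hnc : c ≤ n * n * c := Nat.le_mul_of_pos_left _ (Nat.mul_pos hn hn)
  have p3 : 1 ≤ c * 1 := by omega
  have p2 : 1 ≤ n * (c * 1) := Nat.mul_pos hn p3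
  -- Only the value `n` is ever written, so a filled cell stays filled.
  let Le : (ℕ → ℕ) → (ℕ → ℕ) → Prop := fun m m' => ∀ a, m a = n → m' a = n
  have hrefl : ∀ m, Le m m := fun _ _ h => h
  have htrans : ∀ m m' m'', Le m m' → Le m' m'' → Le m m'' := fun _ _ _ h h' a ha => h' a (h a ha)
  refine (Runs.forLt_of_mono (t := 14) (by omega) (by omega) hn p2 (by omega) (Input ω es) Le
    (fun u m => ∀ v < n, ∀ d < c, m (pos n c B u v d) = n) hrefl htrans
    (fun j m m' hl h v hv d hd => hl _ (h v hv d hd)) hs.r1 hs.r2 hg ?_).weaken le_rfl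
      (fun s' h => ⟨h.1, h.2.1, h.2.2.2⟩)
  intro u hu s₁ k₁ h9 g₁
  have e₁ := hs.keeps k₁ (by omega)
  refine (Runs.forLt_of_mono (t := 10) (by omega) (by omega) hn p3 (by omega) (Input ω es) Le
    (fun v m => ∀ d < c, m (pos n c B u v d) = n) hrefl htrans
    (fun j m m' hl h d hd => hl _ (h d hd)) e₁.r1 e₁.r2 g₁ ?_)
  intro v hv s₂ k₂ h10 g₂
  have e₂ := e₁.keeps k₂ (by omega)
  refine (Runs.forLt_of_mono (t := 6) (by omega) (by omega) hc le_rfl (by omega) (Input ω es) Le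
    (fun d m => m (pos n c B u v d) = n) hrefl htrans
    (fun j m m' hl h => hl _ h) e₂.r1 e₂.r3 g₂ ?_)
  intro d hd s₃ k₃ h11 g₃
  have e₃ := e₂.keeps k₃ (by omega)
  have hp := pos_le (B := B) hu hv hd
  refine Runs.seq (T := 5) (T' := 1)
    (Q := fun s' => s' = ⟨Function.update s₃.reg 14 (pos n c B u v d), s₃.mem⟩)
    (.addr (by omega) (by omega) (by omega) e₃.r2 e₃.r3 e₃.r6
      ((k₃ 9 (by omega)).trans ((k₂ 9 (by omega)).trans h9)) ((k₃ 10 (by omega)).trans h10) h11 hc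
      (by omega) rfl) ?_
  rintro _ rfl
  refine .store ?_
  simp only [Function.update_self, Function.update_of_ne (show (2 : ℕ) ≠ 14 by omega), e₃.r2]
  refine ⟨fun r hr => ?_, g₃.update hB (le_pos ..), fun a ha => ?_, trivial⟩
  · simp [Function.update_of_ne (show r ≠ 14 by omega)]
  · rw [Function.update_apply]; split_ifs <;> simp [ha]

/-- Set the entries of the table for trivial walks and unchanged colours to zero. -/
def Prog.diagonal : Prog :=
  .forLt 9 2 <| .seq (.const 14 3) <| .seq (.arith .add 14 14 9) <| .seq (.load 15 14) <|
    .seq (.addr 14 9 9 15) (.store 14 0)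

theorem Runs.diagonal {s : State} (hn : 1 ≤ n) (hB : n + 3 + 2 * es.length ≤ B)
    (hW : n * n * c + B + 2 * n ≤ W) (hs : Env n c es.length B s) (hg : Good G ω es B s.mem) :
    Runs W .diagonal s (n * 1 * 13) (fun s' => Keeps 9 s s' ∧
      Good G ω es B s'.mem ∧ Complete G ω B 0 s'.mem) := by
  refine (Runs.forLt_of_mono (t := 9) (by omega) (by omega) hn le_rfl (by omega)
    (Good G ω es B) (TLe B) (fun u m => ∀ u' : Fin n, u = u' → m (pos n c B u' u' (ω u')) ≤ 0)
    (TLe.refl B) (fun _ _ _ => TLe.trans)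
    (fun j m m' hl h u hu => (hl _ (le_pos ..)).trans (h u hu)) hs.r1 hs.r2 hg ?_).weaken le_rfl ?_
  swap
  · rintro s' ⟨k, g, -, h⟩
    refine ⟨k, g, fun u v d k hk => ?_⟩
    -- At level `0` only trivial walks in their own colour exist.
    cases hk with
    | refl => exact h u u.2 u rfl
  intro u hu s₁ k₁ h9 g₁
  have e₁ := hs.keeps k₁ (by omega)
  have hcol := g₁.input.colours ⟨u, hu⟩
  have hd := (ω ⟨u, hu⟩).2
  have hnc : c ≤ n * n * c := Nat.le_mul_of_pos_left _ (Nat.mul_pos hn hn)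
  have hp := pos_le (B := B) hu hu hd
  simp only at hcol
  refine Runs.seq (T := 1) (T' := 8)
    (Q := fun s' => s' = ⟨Function.update s₁.reg 14 3, s₁.mem⟩) (.const (by omega) rfl) ?_
  rintro _ rfl
  refine Runs.seq (T := 1) (T' := 7)
    (Q := fun s' => s' = ⟨Function.update s₁.reg 14 (3 + u), s₁.mem⟩) (.arith ?_ ?_) ?_
  · simp [Arith.eval, h9]; omega
  · simp [Arith.eval, h9]
  rintro _ rfl
  refine Runs.seq (T := 1) (T' := 6)
    (Q := fun s' => Keeps 14 s₁ s' ∧ s'.mem = s₁.mem ∧ s'.reg 15 = ω ⟨u, hu⟩)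
    (.load ?_ ⟨fun r hr => ?_, rfl, ?_⟩) ?_
  · simp [hcol]; omega
  · simp [Function.update_of_ne (show r ≠ 14 by omega), Function.update_of_ne (show r ≠ 15 by omega)]
  · simp [hcol]
  rintro s₂ ⟨k₂, m₂, v₂⟩
  have e₂ := e₁.keeps k₂ (by omega)
  have q9 := (k₂ 9 (by omega)).trans h9
  refine Runs.seq (T := 5) (T' := 1)
    (Q := fun s' => s' = ⟨Function.update s₂.reg 14 (pos n c B u u (ω ⟨u, hu⟩)), s₂.mem⟩)
    (.addr (by omega) (by omega) (by omega) e₂.r2 e₂.r3 e₂.r6 q9 q9 v₂ (by omega) (by omega) rfl) ?_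
  rintro _ rfl
  refine .store ?_
  simp only [Function.update_self, Function.update_of_ne (show (0 : ℕ) ≠ 14 by omega), e₂.r0, m₂]
  obtain ⟨a, b⟩ := g₁.update hB (u := ⟨u, hu⟩) (v := ⟨u, hu⟩) (d := ω ⟨u, hu⟩) (Nat.zero_le _)
    (Route.refl _)
  refine ⟨fun r hr => ?_, a, b, ?_⟩
  · simp only [Function.update_of_ne (show r ≠ 14 by omega)]
    exact k₂ r (by omega)
  · rintro u' rfl
    simp

/-- `x` is the least of the entries `(u, v, d)` of the table. -/
def IsMin (n c B : ℕ) (m : ℕ → ℕ) (u v x : ℕ) : Prop :=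
  (∃ d < c, x = m (pos n c B u v d)) ∧ ∀ d < c, x ≤ m (pos n c B u v d)

/-- Write the least entry for each pair of vertices into the first cells. -/
def Prog.output : Prog :=
  .forLt 9 2 <| .forLt 10 2 <| .seq (.arith .mul 11 2 9) <| .seq (.arith .add 11 11 10) <|
    .seq (.store 11 2) <| .forLt 12 3 <| .seq (.look 15 9 10 12) <| .seq (.load 16 11) <|
      .ifLt 15 16 (.store 11 15) .skip

/-- The answers overwrite the input, which is no longer needed; since `n * n ≤ B` they do not reach
the table. -/
theorem Runs.output {s : State} (hn : 1 ≤ n) (hc : 1 ≤ c) (hB : n * n ≤ B)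
    (hW : n * n * c + B + 2 * n ≤ W) (hs : Env n c es.length B s)
    (hle : ∀ (u v : Fin n) (d : Fin c), s.mem (pos n c B u v d) ≤ n) :
    Runs W .output s (n * (n * (c * 1)) * 24) (fun s' =>
      ∀ u < n, ∀ v < n, IsMin n c B s.mem u v (s'.mem (n * u + v))) := by
  have hnc : c ≤ n * n * c := Nat.le_mul_of_pos_left _ (Nat.mul_pos hn hn)
  have p3 : 1 ≤ c * 1 := by omega
  have p2 : 1 ≤ n * (c * 1) := Nat.mul_pos hn p3
  let Tab : (ℕ → ℕ) → Prop := fun m => ∀ a, B ≤ a → m a = s.mem a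
  let Le : (ℕ → ℕ) → (ℕ → ℕ) → Prop := fun m m' => ∀ u < n, ∀ v < n,
    IsMin n c B s.mem u v (m (n * u + v)) → IsMin n c B s.mem u v (m' (n * u + v))
  have hrefl : ∀ m, Le m m := fun _ _ _ _ _ h => h
  have htrans : ∀ m m' m'', Le m m' → Le m' m'' → Le m m'' :=
    fun _ _ _ h h' u hu v hv ha => h' u hu v hv (h u hu v hv ha)
  refine (Runs.forLt_of_mono (t := 20) (by omega) (by omega) hn p2 (by omega) Tab Le
    (fun u m => u < n → ∀ v < n, IsMin n c B s.mem u v (m (n * u + v))) hrefl htrans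
    (fun j m m' hl h hj v hv => hl _ hj _ hv (h hj v hv)) hs.r1 hs.r2 (fun _ _ => rfl) ?_).weaken
      le_rfl (fun s' h u hu => h.2.2.2 u hu hu)
  intro u hu s₁ k₁ h9 g₁
  have e₁ := hs.keeps k₁ (by omega)
  refine (Runs.forLt_of_mono (t := 16) (by omega) (by omega) hn p3 (by omega) Tab Le
    (fun v m => v < n → IsMin n c B s.mem u v (m (n * u + v))) hrefl htrans
    (fun j m m' hl h hj => hl _ hu _ hj (h hj)) e₁.r1 e₁.r2 g₁ ?_).weaken le_rfl
      (fun s' h => ⟨h.1, h.2.1, h.2.2.1, fun _ v hv => h.2.2.2 v hv hv⟩)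
  intro v hv s₂ k₂ h10 g₂
  have e₂ := e₁.keeps k₂ (by omega)
  have q9 := (k₂ 9 (by omega)).trans h9
  have hout : n * u + v < n * n := by nlinarith
  have hpos : ∀ d, n * u + v ≠ pos n c B u v d := fun d => by
    have := le_pos n c B u v d
    omega
  refine (Runs.seq (T := 1) (T' := 2 + c * 1 * 13)
    (Q := fun s' => s' = ⟨Function.update s₂.reg 11 (n * u), s₂.mem⟩) (.arith ?_ ?_) ?_).weaken
    (by omega) (fun _ h => h)
  · simp [Arith.eval, e₂.r2, q9]; omega
  · simp [Arith.eval, e₂.r2, q9]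
  rintro _ rfl
  refine (Runs.seq (T := 1) (T' := 1 + c * 1 * 13)
    (Q := fun s' => s' = ⟨Function.update s₂.reg 11 (n * u + v), s₂.mem⟩) (.arith ?_ ?_) ?_).weaken
    (by omega) (fun _ h => h)
  · simp [Arith.eval, h10]; omega
  · simp [Arith.eval, h10]
  rintro _ rfl
  refine (Runs.seq (T := 1) (T' := c * 1 * 13)
    (Q := fun s' => Keeps 11 s₂ s' ∧ s'.reg 11 = n * u + v ∧
      s'.mem = Function.update s₂.mem (n * u + v) n) (.store ⟨?_, ?_, ?_⟩) ?_)
  · intro r hr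
    simp [Function.update_of_ne (show r ≠ 11 by omega)]
  · simp
  · simp [e₂.r2]
  rintro s₃ ⟨k₃, v₃, m₃⟩
  have e₃ := e₂.keeps k₃ (by omega)
  refine (Runs.forLt (t := 9) (by omega) (by omega) hc le_rfl (by omega)
    (fun j m => (∀ a, a ≠ n * u + v → m a = s₂.mem a) ∧
      (m (n * u + v) = n ∨ ∃ d < j, m (n * u + v) = s.mem (pos n c B u v d)) ∧
      m (n * u + v) ≤ n ∧
      ∀ d < j, m (n * u + v) ≤ s.mem (pos n c B u v d)) e₃.r1 e₃.r3 ?_ ?_).weaken le_rfl ?_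
  · refine ⟨fun a ha => ?_, .inl ?_, ?_, by simp⟩
    · rw [m₃, Function.update_of_ne ha]
    · rw [m₃, Function.update_self]
    · rw [m₃, Function.update_self]
  · rintro j hj s₄ k₄ h12 ⟨a1, a2, a3, a4⟩
    have e₄ := e₃.keeps k₄ (by omega)
    have ht : s₄.mem (pos n c B u v j) = s.mem (pos n c B u v j) := by
      rw [a1 _ (hpos j).symm, g₂ _ (le_pos ..)]
    have hlt := hle ⟨u, hu⟩ ⟨v, hv⟩ ⟨j, hj⟩
    simp only at hlt
    refine (Runs.seq (T := 6) (T' := 3) (.look (u := ⟨u, hu⟩) (v := ⟨v, hv⟩) (e := ⟨j, hj⟩) e₄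
      (by omega) (by omega) (by omega)
      ((k₄ 9 (by omega)).trans ((k₃ 9 (by omega)).trans q9))
      ((k₄ 10 (by omega)).trans ((k₃ 10 (by omega)).trans h10)) h12 (by omega)
      (by simp only [ht]; omega)) ?_)
    rintro _ rfl
    simp only [ht]
    have v₄ := (k₄ 11 (by omega)).trans v₃
    refine Runs.seq (T := 1) (T' := 2)
      (Q := fun s' => Keeps 13 s₄ s' ∧ s'.mem = s₄.mem ∧
        s'.reg 15 = s.mem (pos n c B u v j) ∧ s'.reg 16 = s₄.mem (n * u + v))
      (.load ?_ ⟨fun r hr => ?_, rfl, ?_, ?_⟩) ?_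
    · simp [v₄]; omega
    · simp [Function.update_of_ne (show r ≠ 15 by omega),
        Function.update_of_ne (show r ≠ 16 by omega)]
    · simp
    · simp [v₄]
    rintro s₅ ⟨k₅, m₅, x₅, y₅⟩
    refine .ifLt (fun hl => .store ?_) (fun hl => .skip ?_)
    · rw [x₅, y₅] at hl
      simp only [(k₅ 11 (by omega)).trans v₄, x₅, m₅]
      refine ⟨k₅, fun a ha => ?_, ?_⟩
      · rw [Function.update_of_ne ha, a1 a ha]
      · rw [Function.update_self]
        refine ⟨.inr ⟨j, by omega, rfl⟩, by omega, fun d hd => ?_⟩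
        rcases Nat.lt_succ_iff_lt_or_eq.1 hd with h | rfl
        · exact hl.le.trans (a4 d h)
        · exact le_rfl
    · rw [x₅, y₅] at hl
      rw [m₅]
      refine ⟨k₅, a1, ?_, a3, fun d hd => ?_⟩
      · rcases a2 with h | ⟨d, hd, h⟩
        exacts [.inl h, .inr ⟨d, by omega, h⟩]
      · rcases Nat.lt_succ_iff_lt_or_eq.1 hd with h | rfl
        · exact a4 d h
        · omega
  · rintro s' ⟨k, a1, a2, a3, a4⟩
    have hmin : IsMin n c B s.mem u v (s'.mem (n * u + v)) := by
      refine ⟨?_, a4⟩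
      -- If the starting value `n` was never lowered, it is still attained: all entries are at most
      -- `n`, so the one of colour `0` equals it.
      rcases a2 with h | h
      · have h1 := a4 0 hc
        have h2 := hle ⟨u, hu⟩ ⟨v, hv⟩ ⟨0, hc⟩
        exact ⟨0, hc, le_antisymm h1 (by rw [h]; exact h2)⟩
      · exact h
    refine ⟨?_, ?_, ?_, fun _ => hmin⟩
    · intro r hr
      exact (k₃.mono le_rfl |>.trans (k.mono (by omega))) r (by omega)
    · intro a ha
      rw [a1 a (by omega), g₂ a ha]
    · intro u' hu' v' hv' h
      by_cases he : n * u' + v' = n * u + v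
      -- With one colour and base `0`, table addresses are exactly the output cells.
      · obtain ⟨rfl, rfl, -⟩ := pos_inj (u := u') (u' := u) (B := 0) (c := 1) (d := 0) (d' := 0) hv' hv one_pos one_pos
          (by simp only [pos]; linarith)
        exact hmin
      · rwa [a1 _ he]

end Phases
-- Correctness and resource bounds of the whole program
section Correctness

variable {n c : ℕ} {G : SimpleGraph (Fin n)} {ω : Fin n → Fin c} {es : List (Fin n × Fin n)}
  {B W : ℕ}

/-- `Good` gives one inequality; `Complete` at level `2 * n`, which captures an optimal route by
`Route.level`, gives the other. -/
theorem linkTimeIn_eq {m : ℕ → ℕ} (hg : Good G ω es B m) (hc : Complete G ω B (2 * n) m)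
    (u v : Fin n) (d : Fin c) : linkTimeIn G ω u v d = m (pos n c B u v d) := by
  refine le_antisymm (linkTimeIn_le_iff.2 (hg.route u v d)) ?_
  by_contra hlt
  rw [not_le] at hlt
  obtain ⟨k, hk⟩ := ENat.ne_top_iff_exists.1 hlt.ne_top
  obtain ⟨k', hk', hl⟩ := (linkTimeIn_le_iff.1 hk.symm.le).level
  rw [Fintype.card_fin] at hl
  have h1 := hc u v d k' hl
  rw [← hk] at hlt
  have h2 : k < m (pos n c B u v d) := by exact_mod_cast hlt
  omega

theorem linkTime_eq {m : ℕ → ℕ} (hg : Good G ω es B m) (hc : Complete G ω B (2 * n) m)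
    {u v : Fin n} {x : ℕ} (hx : IsMin n c B m u v x) : (x : ℕ∞) = linkTime G ω u v := by
  obtain ⟨⟨d, hd, rfl⟩, hx⟩ := hx
  refine le_antisymm (le_iInf fun e => ?_) ((iInf_le _ ⟨d, hd⟩).trans ?_)
  · rw [linkTimeIn_eq hg hc]
    exact_mod_cast hx e e.2
  · rw [linkTimeIn_eq hg hc]

theorem length_eq_ncard (h : IsEdgeList G es) : es.length = G.edgeSet.ncard := by
  classical
  have : G.edgeSet = ((es.map (fun e => s(e.1, e.2))).toFinset : Set (Sym2 (Fin n))) := by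
    ext e
    rw [← h.2 e]
    simp
  rw [this, Set.ncard_coe_finset, List.toFinset_card_of_nodup h.1, List.length_map]

theorem length_le_sq (h : IsEdgeList G es) : es.length ≤ n * n := by
  simpa using (List.Nodup.of_map _ h.1).length_le_card

theorem IsEdgeList.adj (h : IsEdgeList G es) {x y : Fin n} (hxy : (x, y) ∈ es) : G.Adj x y := by
  rw [← SimpleGraph.mem_edgeSet, ← h.2]
  exact List.mem_map.2 ⟨_, hxy, rfl⟩

theorem IsEdgeList.mem_or (h : IsEdgeList G es) {x y : Fin n} (hxy : G.Adj x y) :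
    (x, y) ∈ es ∨ (y, x) ∈ es := by
  rw [← SimpleGraph.mem_edgeSet, ← h.2] at hxy
  obtain ⟨⟨a, b⟩, hab, he⟩ := List.mem_map.1 hxy
  rcases Sym2.eq_iff.1 he with ⟨rfl, rfl⟩ | ⟨rfl, rfl⟩
  exacts [.inl hab, .inr hab]

theorem flatMap_pair_getElem? {es : List (Fin n × Fin n)} {e : ℕ} {x y : Fin n}
    (h : es[e]? = some (x, y)) :
    (es.flatMap fun e => [(e.1 : ℕ), (e.2 : ℕ)])[2 * e]? = some (x : ℕ) ∧
      (es.flatMap fun e => [(e.1 : ℕ), (e.2 : ℕ)])[2 * e + 1]? = some (y : ℕ) := by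
  induction es generalizing e with
  | nil => simp at h
  | cons p es ih =>
    cases e with
    | zero =>
      obtain rfl : p = (x, y) := by simpa using h
      simp
    | succ e =>
      obtain ⟨h1, h2⟩ := ih (e := e) (by simpa using h)
      rw [show 2 * (e + 1) = 2 * e + 1 + 1 by ring]
      exact ⟨by simpa using h1, by simpa using h2⟩

theorem input_initState : Input ω es (initState (encode ω es)).mem := by
  constructor
  · intro v
    have hv := v.2
    rw [initState, encode, List.append_assoc]
    simp only [List.getD_eq_getElem?_getD]
    rw [List.getElem?_append_right (by simp), List.getElem?_append_left (by simp)]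
    simp
  · intro e x y he
    obtain ⟨h1, h2⟩ := flatMap_pair_getElem? he
    simp only [initState, encode, List.getD_eq_getElem?_getD]
    rw [List.getElem?_append_right (by simp), List.getElem?_append_right (by simp; omega)]
    have e1 : n + 3 + 2 * e - ([n, c, es.length] ++ List.ofFn fun v => (ω v : ℕ)).length
        = 2 * e := by simp
    have e2 : n + 3 + 2 * e + 1 - ([n, c, es.length] ++ List.ofFn fun v => (ω v : ℕ)).length
        = 2 * e + 1 := by simp; omega
    rw [e1, e2, h1, h2]
    exact ⟨rfl, rfl⟩

/-- Load the constants; registers 0, 1 and 2 are already set. -/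
def Prog.setup : Prog :=
  .seq (.load 3 1) <| .seq (.arith .add 8 1 1) <| .seq (.load 4 8) <| .seq (.const 5 3) <|
    .seq (.arith .add 5 5 2) <| .seq (.arith .mul 6 2 2) <| .seq (.arith .add 6 6 4) <|
      .seq (.arith .add 6 6 4) <| .seq (.arith .add 6 6 5) (.arith .add 7 2 2)

/-- The base address of the table exceeds both the length `n + 3 + 2 * m` of the input and the `n *
n` output cells. -/
theorem Runs.setup {s : State} {n c m : ℕ} (h0 : s.reg 0 = 0) (h1 : s.reg 1 = 1)
    (h2 : s.reg 2 = n) (m1 : s.mem 1 = c) (m2 : s.mem 2 = m) (hcW : c ≤ W)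
    (hW : n * n + m + m + (n + 3) + 2 * n ≤ W) :
    Runs W .setup s 10 (fun s' => s'.mem = s.mem ∧
      Env n c m (n * n + m + m + (n + 3)) s') := by
  have w₁ : 1 + 1 ≤ W := by omega
  have w₂ : m ≤ W := by omega
  have w₃ : 3 ≤ W := by omega
  have w₄ : 3 + n ≤ W := by omega
  have w₅ : n * n ≤ W := by omega
  have w₆ : n * n + m ≤ W := by omega
  have w₇ : n * n + m + m ≤ W := by omega
  have w₈ : n * n + m + m + (n + 3) ≤ W := by omega
  have w₉ : n + n ≤ W := by omega
  refine Runs.seq (T := 1) (T' := 9) (Q := fun s' => s'.mem = s.mem ∧ s'.reg 0 = 0 ∧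
    s'.reg 1 = 1 ∧ s'.reg 2 = n ∧ s'.reg 3 = c) (.load ?_ ?_) ?_
  · rw [h1, m1]; exact hcW
  · simp [h0, h1, h2, m1]
  rintro s₁ ⟨m₁, a0, a1, a2, a3⟩
  refine Runs.seq (T := 1) (T' := 8) (Q := fun s' => s'.mem = s.mem ∧ s'.reg 0 = 0 ∧
    s'.reg 1 = 1 ∧ s'.reg 2 = n ∧ s'.reg 3 = c ∧ s'.reg 8 = 2) (.arith ?_ ?_) ?_
  · simpa [Arith.eval, a1] using w₁
  · simp [Arith.eval, m₁, a0, a1, a2, a3]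
  rintro s₂ ⟨m₂, a0, a1, a2, a3, a8⟩
  refine Runs.seq (T := 1) (T' := 7) (Q := fun s' => s'.mem = s.mem ∧ s'.reg 0 = 0 ∧
    s'.reg 1 = 1 ∧ s'.reg 2 = n ∧ s'.reg 3 = c ∧ s'.reg 4 = m) (.load ?_ ?_) ?_
  · rw [a8, m₂, m2]; exact w₂
  · simp [m₂, a0, a1, a2, a3, a8, m2]
  rintro s₃ ⟨m₃, a0, a1, a2, a3, a4⟩
  refine Runs.seq (T := 1) (T' := 6) (Q := fun s' => s'.mem = s.mem ∧ s'.reg 0 = 0 ∧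
    s'.reg 1 = 1 ∧ s'.reg 2 = n ∧ s'.reg 3 = c ∧ s'.reg 4 = m ∧ s'.reg 5 = 3) (.const ?_ ?_) ?_
  · exact w₃
  · simp [m₃, a0, a1, a2, a3, a4]
  rintro s₄ ⟨m₄, a0, a1, a2, a3, a4, a5⟩
  refine Runs.seq (T := 1) (T' := 5) (Q := fun s' => s'.mem = s.mem ∧ s'.reg 0 = 0 ∧
    s'.reg 1 = 1 ∧ s'.reg 2 = n ∧ s'.reg 3 = c ∧ s'.reg 4 = m ∧ s'.reg 5 = n + 3)
    (.arith ?_ ?_) ?_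
  · simpa [Arith.eval, a5, a2] using w₄
  · simp [Arith.eval, m₄, a0, a1, a2, a3, a4, a5, add_comm]
  rintro s₅ ⟨m₅, a0, a1, a2, a3, a4, a5⟩
  -- Common form of the four instructions that accumulate the base address in register 6.
  have step : ∀ {s₀ : State} {P : Prog} {f : Arith} {a b k l T' : ℕ}, s₀.mem = s.mem →
      s₀.reg 0 = 0 → s₀.reg 1 = 1 → s₀.reg 2 = n → s₀.reg 3 = c → s₀.reg 4 = m →
      s₀.reg 5 = n + 3 → f.eval (s₀.reg a) (s₀.reg b) = k → k ≤ W →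
      (∀ s', s'.mem = s.mem → s'.reg 0 = 0 → s'.reg 1 = 1 → s'.reg 2 = n → s'.reg 3 = c →
        s'.reg 4 = m → s'.reg 5 = n + 3 → s'.reg 6 = k → Runs W P s' T' (fun s' => s'.mem = s.mem ∧
          Env n c m l s')) →
      Runs W (.seq (.arith f 6 a b) P) s₀ (1 + T') (fun s' => s'.mem = s.mem ∧ Env n c m l s') := by
    intro s₀ P f a b k l T' hm b0 b1 b2 b3 b4 b5 hk hkW hP
    refine Runs.seq (Q := fun s' => s' = ⟨Function.update s₀.reg 6 k, s₀.mem⟩)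
      (.arith (hk ▸ hkW) (by rw [hk])) ?_
    rintro _ rfl
    exact hP _ hm (by simpa using b0) (by simpa using b1) (by simpa using b2) (by simpa using b3)
      (by simpa using b4) (by simpa using b5) (by simp)
  refine step (T' := 4) (k := n * n) m₅ a0 a1 a2 a3 a4 a5 (by simp [Arith.eval, a2]) w₅ ?_
  intro s₆ m₆ a0 a1 a2 a3 a4 a5 a6
  refine step (T' := 3) (k := n * n + m) m₆ a0 a1 a2 a3 a4 a5 (by simp [Arith.eval, a6, a4])
    w₆ ?_
  intro s₇ m₇ a0 a1 a2 a3 a4 a5 a6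
  refine step (T' := 2) (k := n * n + m + m) m₇ a0 a1 a2 a3 a4 a5 (by simp [Arith.eval, a6, a4])
    w₇ ?_
  intro s₈ m₈ a0 a1 a2 a3 a4 a5 a6
  refine step (T' := 1) (k := n * n + m + m + (n + 3)) m₈ a0 a1 a2 a3 a4 a5
    (by simp [Arith.eval, a6, a5]) w₈ ?_
  intro s₉ m₉ a0 a1 a2 a3 a4 a5 a6
  refine .arith ?_ ⟨m₉, ?_⟩
  · simpa [Arith.eval, a2] using w₉
  · constructor <;> simp [Arith.eval, a0, a1, a2, a3, a4, a5, a6, two_mul]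

/-- The part of the program for graphs with at least two vertices. -/
def Prog.body : Prog :=
  .seq .setup <| .seq .fill <| .seq .diagonal <| .seq (.forLt 8 7 .round) .output

theorem Runs.body {s : State} (hn : 1 ≤ n) (hc : 1 ≤ c) (hm : 1 ≤ es.length) (hG : G.Connected)
    (he : IsEdgeList G es) (hB : n * n + es.length + es.length + (n + 3) = B)
    (hW : n * n * c + B + 2 * n ≤ W) (h0 : s.reg 0 = 0) (h1 : s.reg 1 = 1) (h2 : s.reg 2 = n)
    (m1 : s.mem 1 = c) (m2 : s.mem 2 = es.length) (hi : Input ω es s.mem) :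
    Runs W .body s (215 * (n ^ 3 * es.length * c ^ 2) + 10) (fun s' =>
      ∀ u v : Fin n, (s'.mem (n * (u : ℕ) + (v : ℕ)) : ℕ∞) = linkTime G ω u v) := by
  have hnc : c ≤ n * n * c := Nat.le_mul_of_pos_left _ (Nat.mul_pos hn hn)
  have hB' : n + 3 + 2 * es.length ≤ B := by omega
  have key : Runs W .body s (10 + (n * (n * (c * 1)) * 18 + (n * 1 * 13 +
      (2 * n * (n * (n * (c * (es.length * (c * 1))))) * 80 + n * (n * (c * 1)) * 24))))
      (fun s' => ∀ u v : Fin n, (s'.mem (n * (u : ℕ) + (v : ℕ)) : ℕ∞) = linkTime G ω u v) := by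
    refine (Runs.setup h0 h1 h2 m1 m2 (by omega) (by omega)).seq ?_
    rw [hB]
    rintro s₁ ⟨m₁, e₁⟩
    refine (Runs.fill hn hc hB' hW e₁ (m₁ ▸ hi)).seq ?_
    rintro s₂ ⟨k₂, i₂, f₂⟩
    have e₂ := e₁.keeps k₂ (by omega)
    have g₂ : Good G ω es B s₂.mem := by
      refine ⟨i₂, fun u v d => ?_, fun u v d => (f₂ u u.2 v v.2 d d.2).le⟩
      rw [f₂ u u.2 v v.2 d d.2]
      simpa using Route.card hG ω u v d
    refine (Runs.diagonal hn hB' hW e₂ g₂).seq ?_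
    rintro s₃ ⟨k₃, g₃, c₃⟩
    have e₃ := e₂.keeps k₃ (by omega)
    refine (Runs.rounds hn hc hm (fun _ _ => he.adj) (fun _ _ => he.mem_or) hB' hW e₃ g₃ c₃).seq ?_
    rintro s₄ ⟨k₄, g₄, c₄⟩
    have e₄ := e₃.keeps k₄ (by omega)
    refine (Runs.output hn hc (by omega) hW e₄ g₄.le).weaken le_rfl ?_
    intro s' h u v
    exact linkTime_eq g₄ c₄ (h u u.2 v v.2)
  refine key.weaken ?_ (fun _ h => h)
  have x1 : n * (n * (c * 1)) ≤ n ^ 3 * es.length * c ^ 2 :=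
    calc n * (n * (c * 1)) = n * n * c * 1 := by ring
      _ ≤ n * n * c * (n * es.length * c) :=
        Nat.mul_le_mul_left _ (Nat.mul_pos (Nat.mul_pos hn hm) hc)
      _ = _ := by ring
  have x2 : n ≤ n * (n * (c * 1)) := Nat.le_mul_of_pos_right _ (Nat.mul_pos hn (by omega))
  have x3 : 2 * n * (n * (n * (c * (es.length * (c * 1))))) * 80 =
    160 * (n ^ 3 * es.length * c ^ 2) := by ring
  -- The phases contribute `18 + 13 + 160 + 24 = 215`; the lower-order terms are absorbed because
  -- `n`, `c` and the number of edges are positive.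
  omega

/-- The whole program. -/
def Prog.main : Prog :=
  .seq (.const 1 1) <| .seq (.load 2 0) <| .ifLt 1 2 .body (.store 0 0)

/-- A single vertex has no edges, so only the additive constant is available as time, and the answer
`0` is written directly. With two or more vertices, connectedness supplies an edge and `Runs.body`
applies. -/
theorem Runs.main (hG : G.Connected) (he : IsEdgeList G es)
    (hW : n * n * c + (n * n + es.length + es.length + (n + 3)) + 2 * n ≤ W) :
    Runs W .main (initState (encode ω es)) (215 * (n ^ 3 * es.length * c ^ 2) + 13) (fun s' =>
      ∀ u v : Fin n, (s'.mem (n * (u : ℕ) + (v : ℕ)) : ℕ∞) = linkTime G ω u v) := by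
  obtain ⟨z⟩ := hG.nonempty
  have hn : 1 ≤ n := Nat.one_le_iff_ne_zero.2 fun h => by subst h; exact z.elim0
  have hc : 1 ≤ c := Nat.one_le_iff_ne_zero.2 fun h => by subst h; exact (ω z).elim0
  refine (Runs.seq (T := 1) (T' := 215 * (n ^ 3 * es.length * c ^ 2) + 12)
    (Q := fun s' => s' = ⟨Function.update (fun _ => 0) 1 1, (initState (encode ω es)).mem⟩)
    (.const (by omega) rfl) ?_).weaken (by omega) (fun _ h => h)
  rintro _ rfl
  have m0 : (initState (encode ω es)).mem 0 = n := by simp [initState, encode]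
  refine (Runs.seq (T := 1) (T' := 215 * (n ^ 3 * es.length * c ^ 2) + 11)
    (Q := fun s' => s'.reg 0 = 0 ∧ s'.reg 1 = 1 ∧ s'.reg 2 = n ∧
      s'.mem = (initState (encode ω es)).mem) (.load ?_ ?_) ?_).weaken (by omega) (fun _ h => h)
  · simp [m0]; omega
  · simp [m0]
  rintro s ⟨r0, r1, r2, hm⟩
  refine .ifLt (fun hlt => ?_) (fun hlt => ?_)
  · rw [r1, r2] at hlt
    have hE : 1 ≤ es.length := by
      rw [Nat.one_le_iff_ne_zero]
      intro h0
      have : Nontrivial (Fin n) := Fin.nontrivial_iff_two_le.2 hlt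
      obtain ⟨y, hy⟩ := hG.preconnected.exists_adj_of_nontrivial z
      rw [List.length_eq_zero_iff] at h0
      subst h0
      simpa using he.mem_or hy
    refine Runs.body hn hc hE hG he rfl hW r0 r1 r2 ?_ ?_ ?_
    · rw [hm]; simp [initState, encode]
    · rw [hm]; simp [initState, encode]
    · rw [hm]; exact input_initState
  · rw [r1, r2] at hlt
    obtain rfl : n = 1 := by omega
    refine (Runs.store (Q := fun s' => s'.mem 0 = 0) ?_).weaken (by omega) ?_
    · simp [r0]
    · intro s' h u v
      obtain rfl : u = v := Subsingleton.elim _ _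
      have hu : (u : ℕ) = 0 := by omega
      have : linkTime G ω u u ≤ (0 : ℕ) :=
        (iInf_le _ (ω u)).trans (linkTimeIn_le_iff.2 (Route.refl u))
      simp only [hu, h]
      simpa using this.antisymm (by simp) |>.symm

end Correctness
end FloodIt

theorem mainTheorem2 :
    ∃ (P : FloodIt.Prog) (K : ℕ),
      ∀ (n c : ℕ) (G : SimpleGraph (Fin n)) (ω : Fin n → Fin c) (es : List (Fin n × Fin n)),
        G.Connected → FloodIt.IsEdgeList G es →
          ∃ (s : FloodIt.State) (t : ℕ),
            FloodIt.Exec (K * (n + c) ^ K) P (FloodIt.initState (FloodIt.encode ω es)) s t ∧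
            t ≤ K * (n ^ 3 * G.edgeSet.ncard * c ^ 2) + K ∧
            ∀ u v : Fin n, (s.mem (n * (u : ℕ) + (v : ℕ)) : ℕ∞) = FloodIt.linkTime G ω u v := by
  refine ⟨.main, 215, fun n c G ω es hG he => ?_⟩
  have hW : n * n * c + (n * n + es.length + es.length + (n + 3)) + 2 * n ≤
      215 * (n + c) ^ 215 := by
    have hm := FloodIt.length_le_sq he
    obtain ⟨z⟩ := hG.nonempty
    have hn : 1 ≤ n := Nat.one_le_iff_ne_zero.2 fun h => by subst h; exact z.elim0
    have h3 : (n + c) ^ 3 ≤ (n + c) ^ 215 := Nat.pow_le_pow_right (by omega) (by omega)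
    have h1 : n * n * c ≤ (n + c) ^ 3 := by
      rw [pow_succ, pow_two]; gcongr <;> omega
    have h2 : n * n ≤ (n + c) ^ 3 :=
      calc n * n = n ^ 2 := by ring
        _ ≤ (n + c) ^ 2 := by gcongr; omega
        _ ≤ _ := Nat.pow_le_pow_right (by omega) (by omega)
    have h4 : n ≤ n * n := Nat.le_mul_of_pos_left _ hn
    -- All terms are bounded by multiples of `(n + c) ^ 3`, using `|E| ≤ n * n`; with the powers
    -- made opaque the estimate is linear.
    generalize (n + c) ^ 215 = X at *
    generalize (n + c) ^ 3 = Y at *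
    omega
  obtain ⟨s, t, h1, h2, h3⟩ := FloodIt.Runs.main (ω := ω) hG he hW
  refine ⟨s, t, h1, ?_, h3⟩
  rw [← FloodIt.length_eq_ncard he]
  omega
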